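/- Let $k$ be a field, let $B$ be a polynomial ring over $k$ in finitely many variables, graded so that the variables are homogeneous of positive (possibly different) degrees, and let $G$ be a finite group acting faithfully on $B$ by degree-preserving $k$-algebra automorphisms. Let $A=B^G$, let $\mathfrak m_A,\mathfrak m_B$ be the irrelevant maximal ideals of $A$ and $B$, and let $\hat A$, $\hat B$ be the $\mathfrak m_A$-adic completion of $A$ and the $\mathfrak m_B$-adic completion of $B$, with the induced action of $G$ on $\hat B$. Let $B*G$ and $\hat B*G$ be the twisted group algebras, with product $(rg)(r'g')=(r\,(gr'))(gg')$. Assume that the action of $G$ on $B$ is small: there is a $G$-stable open subset $U$ of $X=\operatorname{Spec}B$ on which $G$ acts freely (all inertia groups of points of $U$ are trivial) and such that $X\setminus U$ has codimension at least two in $X$. For a finite-dimensional $kG$-module $V$, regard $B\otimes_kV$ as a $B*G$-module and $\hat B\otimes_kV$ as an $\hat B*G$-module, where $G$ acts diagonally and $B$ (respectively $\hat B$) acts on the left factor; let $M_V=(B\otimes_kV)^G$, an $A$-module, and let the $\hat A$-module $\hat M_V$ be its $\mathfrak m_A$-adic completion. A module is called indecomposable if it is nonzero and is not the direct sum of two nonzero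 submodules. 1. For every finite-dimensional $kG$-module $V$ the following are equivalent: (a) $V$ is an indecomposable $kG$-module; (b) $B\otimes_kV$ is an indecomposable $B*G$-module; (b^) $\hat B\otimes_kV$ is an indecomposable $\hat B*G$-module; (c) $M_V$ is an indecomposable $A$-module; (c^) $\hat M_V$ is an indecomposable $\hat A$-module. 2. For all finite-dimensional $kG$-modules $V,V'$ the following are equivalent: (a) $V\cong V'$ as $kG$-modules; (b) $B\otimes_kV\cong B\otimes_kV'$ as $B*G$-modules; (b^) $\hat B\otimes_kV\cong\hat B\otimes_kV'$ as $\hat B*G$-modules; (c) $M_V\cong M_{V'}$ as $A$-modules; (c^) $\hat M_V\cong\hat M_{V'}$ as $\hat A$-modules. -/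

import Mathlib

open scoped TensorProduct

noncomputable section

/-- A module is indecomposable if it is nonzero and is not the direct sum of two nonzero
submodules. -/
def IsIndecomposableModule (S M : Type*) [Ring S] [AddCommGroup M] [Module S M] : Prop :=
  Nontrivial M ∧ ∀ N N' : Submodule S M, IsCompl N N' → N = ⊥ ∨ N' = ⊥

section Grading

variable {k B : Type*} [Field k] [CommRing B] [Algebra k B] (𝒜 : ℕ → Submodule k B)

/-- The graded `k`-algebra `B = ⨁ 𝒜 n` is a polynomial ring over `k` in finitely many
homogeneous generators of (possibly different) positive degrees. -/
def IsGradedPolynomialRing : Prop :=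
  ∃ (r : ℕ) (d : Fin r → ℕ) (x : Fin r → B),
    (∀ i, 0 < d i ∧ x i ∈ 𝒜 (d i)) ∧
      AlgebraicIndependent k x ∧ Algebra.adjoin k (Set.range x) = ⊤

/-- `G` acts on `B` by degree-preserving maps. -/
class IsGradedAction (G : Type*) [Group G] [MulSemiringAction G B] : Prop where
  smul_mem : ∀ (g : G) (n : ℕ) (b : B), b ∈ 𝒜 n → g • b ∈ 𝒜 n

/-- The irrelevant ideal `𝔪_B = ⨁_{n > 0} 𝒜 n`. -/
abbrev irrelevantIdeal [GradedAlgebra 𝒜] : Ideal B := (HomogeneousIdeal.irrelevant 𝒜).toIdeal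

/-- The irrelevant ideal `𝔪_A = 𝔪_B ∩ A` of the graded ring of invariants `A = B^G`. -/
abbrev invariantIrrelevantIdeal [GradedAlgebra 𝒜] (G : Type*) [Group G] [MulSemiringAction G B]
    [SMulCommClass G k B] : Ideal (FixedPoints.subalgebra k B G) :=
  (irrelevantIdeal 𝒜).comap (algebraMap (FixedPoints.subalgebra k B G) B)

end Grading

section Small

/-- The codimension of a closed subset of an affine scheme (`⊤` for the empty set). -/
def specCodim {B : Type*} [CommRing B] (Z : Set (PrimeSpectrum B)) : ℕ∞ :=
  ⨅ x ∈ Z, x.asIdeal.height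

/-- The action of `G` on `B` is small: there is a `G`-stable open subset `U` of `Spec B`, with
complement of codimension at least two, on which `G` acts freely. Freeness (no nontrivial element
of `G` fixes a point of `U` with values in a field) says that all points of `U` have trivial
inertia group. -/
def IsSmallAction (G B : Type*) [Group G] [CommRing B] [MulSemiringAction G B] : Prop :=
  ∃ U : TopologicalSpace.Opens (PrimeSpectrum B),
    (∀ (g : G), ∀ x ∈ U, PrimeSpectrum.comap (MulSemiringAction.toRingHom G B g) x ∈ U) ∧
    (∀ x ∈ U, x.asIdeal.inertia G = ⊥) ∧
    2 ≤ specCodim (U : Set (PrimeSpectrum B))ᶜ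

end Small

section Completion

variable {B : Type*} [CommRing B]

/-- The ideal `I` is stable under `G`. -/
class IsStableIdeal (G : Type*) [Group G] [MulSemiringAction G B] (I : Ideal B) : Prop where
  smul_mem : ∀ (g : G) (b : B), b ∈ I → g • b ∈ I

variable (G : Type*) [Group G] [MulSemiringAction G B] (I : Ideal B) [IsStableIdeal G I]

theorem pow_le_comap_of_isStableIdeal (g : G) (n : ℕ) :
    I ^ n ≤ (I ^ n).comap (MulSemiringAction.toRingHom G B g) := by
  have h : I ≤ I.comap (MulSemiringAction.toRingHom G B g) :=
    fun b hb => IsStableIdeal.smul_mem g b hb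
  exact (Ideal.pow_right_mono h n).trans (Ideal.le_comap_pow _ n)

/-- The map `b ↦ g • b` on `B ⧸ I ^ n`. -/
def quotientPowSMul (g : G) (n : ℕ) : B ⧸ I ^ n →+* B ⧸ I ^ n :=
  Ideal.quotientMap (I ^ n) (MulSemiringAction.toRingHom G B g)
    (pow_le_comap_of_isStableIdeal G I g n)

theorem factorPow_comp_quotientPowSMul (g : G) {m n : ℕ} (hle : m ≤ n) :
    (Ideal.Quotient.factorPow I hle).comp (quotientPowSMul G I g n) =
      (quotientPowSMul G I g m).comp (Ideal.Quotient.factorPow I hle) := by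
  ext b
  rfl

theorem factorPow_evalₐ {m n : ℕ} (hle : m ≤ n) (x : AdicCompletion I B) :
    Ideal.Quotient.factorPow I hle (AdicCompletion.evalₐ I n x) = AdicCompletion.evalₐ I m x := by
  induction x using AdicCompletion.induction_on with
  | _ a =>
    rw [AdicCompletion.evalₐ_mk, AdicCompletion.evalₐ_mk]
    have h := a.property hle
    rw [SModEq.sub_mem] at h
    refine Ideal.Quotient.eq.mpr ?_
    simpa using neg_mem h

theorem factorPow_comp_quotientPowSMul_evalₐ (g : G) {m n : ℕ} (hle : m ≤ n) :
    (Ideal.Quotient.factorPow I hle).comp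
        ((quotientPowSMul G I g n).comp (AdicCompletion.evalₐ I n : AdicCompletion I B →+* B ⧸ I ^ n)) =
      (quotientPowSMul G I g m).comp (AdicCompletion.evalₐ I m : AdicCompletion I B →+* B ⧸ I ^ m) := by
  rw [← RingHom.comp_assoc, factorPow_comp_quotientPowSMul, RingHom.comp_assoc]
  congr 1
  ext x
  exact factorPow_evalₐ I hle x

/-- The ring endomorphism induced by `b ↦ g • b` on the `I`-adic completion of `B`. -/
def completionSMul (g : G) : AdicCompletion I B →+* AdicCompletion I B :=
  AdicCompletion.liftRingHom I
    (fun n => (quotientPowSMul G I g n).comp (AdicCompletion.evalₐ I n : AdicCompletion I B →+* B ⧸ I ^ n))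
    (fun hle => factorPow_comp_quotientPowSMul_evalₐ G I g hle)

theorem evalₐ_completionSMul (g : G) (n : ℕ) (x : AdicCompletion I B) :
    AdicCompletion.evalₐ I n (completionSMul G I g x) =
      quotientPowSMul G I g n (AdicCompletion.evalₐ I n x) :=
  AdicCompletion.evalₐ_liftRingHom I
    (fun n => (quotientPowSMul G I g n).comp (AdicCompletion.evalₐ I n : AdicCompletion I B →+* B ⧸ I ^ n))
    (fun hle => factorPow_comp_quotientPowSMul_evalₐ G I g hle) n x

/-- The action of `G` on the `I`-adic completion of `B` induced by functoriality. -/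
instance completionAction : MulSemiringAction G (AdicCompletion I B) where
  smul g x := completionSMul G I g x
  one_smul x := by
    refine AdicCompletion.ext_evalₐ fun n => ?_
    refine (evalₐ_completionSMul G I 1 n x).trans ?_
    obtain ⟨b, hb⟩ := Ideal.Quotient.mk_surjective (AdicCompletion.evalₐ I n x)
    rw [← hb]
    exact congrArg (Ideal.Quotient.mk (I ^ n)) (one_smul G b)
  mul_smul g h x := by
    refine AdicCompletion.ext_evalₐ fun n => ?_
    refine (evalₐ_completionSMul G I (g * h) n x).trans ?_
    refine Eq.trans ?_ (evalₐ_completionSMul G I g n (completionSMul G I h x)).symm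
    rw [evalₐ_completionSMul]
    obtain ⟨b, hb⟩ := Ideal.Quotient.mk_surjective (AdicCompletion.evalₐ I n x)
    rw [← hb]
    exact congrArg (Ideal.Quotient.mk (I ^ n)) (mul_smul g h b)
  smul_zero g := map_zero (completionSMul G I g)
  smul_add g := map_add (completionSMul G I g)
  smul_one g := map_one (completionSMul G I g)
  smul_mul g := map_mul (completionSMul G I g)

/-- The action on the completion extends the action on `B`. -/
theorem completion_smul_of (g : G) (b : B) :
    g • AdicCompletion.of I B b = AdicCompletion.of I B (g • b) := by
  refine AdicCompletion.ext_evalₐ fun n => ?_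
  refine (evalₐ_completionSMul G I g n _).trans ?_
  rw [AdicCompletion.evalₐ_of, AdicCompletion.evalₐ_of]
  rfl

instance completion_smulCommClass (k : Type*) [CommRing k] [Algebra k B] [SMulCommClass G k B] :
    SMulCommClass G k (AdicCompletion I B) where
  smul_comm g c x := by
    have h : g • algebraMap k (AdicCompletion I B) c = algebraMap k (AdicCompletion I B) c := by
      rw [AdicCompletion.algebraMap_apply, completion_smul_of, smul_algebraMap]
    rw [Algebra.smul_def, Algebra.smul_def, smul_mul', h]

end Completion

section GradedStable

variable {k B : Type*} [Field k] [CommRing B] [Algebra k B] (𝒜 : ℕ → Submodule k B)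
  [GradedAlgebra 𝒜] (G : Type*) [Group G] [MulSemiringAction G B]

instance isStableIdeal_irrelevantIdeal [IsGradedAction 𝒜 G] :
    IsStableIdeal G (irrelevantIdeal 𝒜) where
  smul_mem g b hb := by
    classical
    have hb0 : GradedRing.proj 𝒜 0 b = 0 := hb
    change g • b ∈ HomogeneousIdeal.irrelevant 𝒜
    rw [← DirectSum.sum_support_decompose 𝒜 b, Finset.smul_sum]
    refine sum_mem fun i _ => ?_
    rcases Nat.eq_zero_or_pos i with rfl | hi
    · have h0 : (DirectSum.decompose 𝒜 b 0 : B) = 0 := hb0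
      rw [h0, smul_zero]
      exact zero_mem _
    · exact HomogeneousIdeal.mem_irrelevant_of_mem 𝒜 hi
        (IsGradedAction.smul_mem g i _ (SetLike.coe_mem _))

end GradedStable

section Twisted

variable {k G V : Type*} [Field k] [Group G] [AddCommGroup V] [Module k V]
  (R : Type*) [CommRing R] [Algebra k R] [MulSemiringAction G R] [SMulCommClass G k R]
  (ρ : Representation k G V)

/-- The tensor product `R ⊗ V` over `k`, on which `R` acts through the left factor and `G` acts
diagonally. -/
@[nolint unusedArguments]
def TwistedTensor (_ : Representation k G V) : Type _ := R ⊗[k] V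

namespace TwistedTensor

instance : AddCommGroup (TwistedTensor R ρ) := inferInstanceAs (AddCommGroup (R ⊗[k] V))

instance : Module R (TwistedTensor R ρ) := inferInstanceAs (Module R (R ⊗[k] V))

instance : Module k (TwistedTensor R ρ) := inferInstanceAs (Module k (R ⊗[k] V))

instance : IsScalarTower k R (TwistedTensor R ρ) :=
  inferInstanceAs (IsScalarTower k R (R ⊗[k] V))

/-- The diagonal action `g (r ⊗ v) = g r ⊗ g v`. -/
def diag : Representation k G (TwistedTensor R ρ) :=
  (Representation.ofDistribMulAction k G R).tprod ρ

theorem diag_tmul (g : G) (r : R) (v : V) :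
    diag R ρ g (show TwistedTensor R ρ from r ⊗ₜ[k] v) =
      (show TwistedTensor R ρ from (g • r) ⊗ₜ[k] ρ g v) := rfl

theorem diag_smul (g : G) (r : R) (x : TwistedTensor R ρ) :
    diag R ρ g (r • x) = (g • r) • diag R ρ g x := by
  refine TensorProduct.induction_on x ?_ ?_ ?_
  · exact ((congrArg (diag R ρ g) (smul_zero r)).trans (map_zero _)).trans
      ((congrArg ((g • r) • ·) (map_zero (diag R ρ g))).trans (smul_zero _)).symm
  · intro s v
    change (g • (r * s)) ⊗ₜ[k] ρ g v = ((g • r) * (g • s)) ⊗ₜ[k] ρ g v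
    rw [smul_mul']
  · intro a b ha hb
    refine ((congrArg (diag R ρ g) (smul_add r a b)).trans (map_add _ _ _)).trans ?_
    refine Eq.trans ?_
      ((congrArg ((g • r) • ·) (map_add (diag R ρ g) a b)).trans (smul_add _ _ _)).symm
    exact congrArg₂ (· + ·) ha hb

/-- The ring homomorphism from the twisted group algebra `R * G`, in which
`(r g) (r' g') = (r (g r')) (g g')`, to the endomorphisms of `R ⊗ V`, which sends `r g` to
`x ↦ r • g x`. -/
def twistedHom : SkewMonoidAlgebra R G →+* Module.End k (TwistedTensor R ρ) :=
  SkewMonoidAlgebra.liftNCRingHom (Algebra.lsmul k k (TwistedTensor R ρ)).toRingHom (diag R ρ)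
    (fun {r g} => LinearMap.ext fun x => (diag_smul R ρ g r x).symm)

/-- `R ⊗ V` as a module over the twisted group algebra `R * G`. -/
instance : Module (SkewMonoidAlgebra R G) (TwistedTensor R ρ) :=
  Module.compHom _ (twistedHom R ρ)

theorem single_smul (g : G) (r : R) (x : TwistedTensor R ρ) :
    SkewMonoidAlgebra.single g r • x = r • diag R ρ g x := by
  change twistedHom R ρ (SkewMonoidAlgebra.single g r) x = _
  unfold twistedHom
  erw [SkewMonoidAlgebra.liftNC_single]
  rfl

/-- The module of invariants `(R ⊗ V)^G` over the ring of invariants `R^G`. -/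
def invariants : Submodule (FixedPoints.subalgebra k R G) (TwistedTensor R ρ) where
  carrier := {x | ∀ g : G, diag R ρ g x = x}
  zero_mem' g := map_zero _
  add_mem' {x y} hx hy g := by rw [map_add, hx g, hy g]
  smul_mem' a x hx g := by
    change diag R ρ g ((a : R) • x) = (a : R) • x
    rw [diag_smul, hx g, a.property g]

end TwistedTensor

end Twisted

end

/-!
The five classes of modules are linked by a cycle of additive functors, given on morphisms by

`Hom_kG(V, V') → Hom_{B*G}(B ⊗ V, B ⊗ V') → Hom_A(M, M') → Hom_Â(M̂, M̂') →`
`Hom_{B̂*G}(B̂ ⊗ V, B̂ ⊗ V') → Hom_kG(V, V')`: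

base change, restriction to invariants, completion, unique extension along `M̂ → B̂ ⊗ V`, and
reduction modulo the maximal ideal. Isomorphisms are carried forward around the cycle.
Indecomposability is carried backward: it says that an endomorphism ring is nonzero and has only
the idempotents `0` and `1`, the first four functors are injective on endomorphisms, and the last
one kills no nonzero idempotent.

Smallness enters through the extension. Over the locus where `G` acts freely, descent makes a
`B`-module with semilinear `G`-action generated by its invariants. Quantitatively: call `s : B` a
freeness element if `s` times the indicator function of `1 : G` is a `B`-combination of the orbit
maps `g ↦ g • b`; then `s • x` is a `B`-combination of traces, for every `x`. So a map defined on
invariants extends after multiplication by `s`. By smallness the ideal of freeness elements has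
height at least two, hence contains a weakly regular pair `s, t` as `B` is factorial, and the two
extensions with denominators `s` and `t` glue to one without denominators.
-/

section Indecomposable

variable {S M T N : Type*} [Ring S] [AddCommGroup M] [Module S M] [Ring T] [AddCommGroup N]
  [Module T N]

theorem isIndecomposableModule_iff_end :
    IsIndecomposableModule S M ↔
      Nontrivial (Module.End S M) ∧ ∀ e : Module.End S M, IsIdempotentElem e → e = 0 ∨ e = 1 := by
  constructor
  · rintro ⟨_, h⟩
    refine ⟨inferInstance, fun e he => (h _ _ (LinearMap.IsIdempotentElem.isCompl he)).imp
      LinearMap.range_eq_bot.mp fun hker => LinearMap.ext fun x => ?_⟩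
    exact LinearMap.ker_eq_bot.mp hker (LinearMap.congr_fun he x)
  · rintro ⟨_, h⟩
    refine ⟨?_, fun N N' hc => (h _ (Submodule.isIdempotentElem_projection hc)).imp
      (fun h0 => ?_) fun h1 => ?_⟩
    · by_contra hM
      rw [not_nontrivial_iff_subsingleton] at hM
      exact not_subsingleton (Module.End S M) inferInstance
    · rw [← Submodule.range_projection hc, h0, LinearMap.range_zero]
    · rw [← Submodule.ker_projection hc, h1]
      exact LinearMap.ker_id

theorem IsIndecomposableModule.of_ringHom (F : Module.End T N →+* Module.End S M)
    (hF : ∀ e, IsIdempotentElem e → F e = 0 → e = 0) (h : IsIndecomposableModule S M) :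
    IsIndecomposableModule T N := by
  rw [isIndecomposableModule_iff_end] at h ⊢
  obtain ⟨_, h⟩ := h
  refine ⟨F.domain_nontrivial, fun e he => (h (F e) (he.map F)).imp (hF e he) fun h1 => ?_⟩
  have hcompl : 1 - e = 0 := hF _ he.one_sub (by rw [map_sub, map_one, h1, sub_self])
  exact (sub_eq_zero.mp hcompl).symm

theorem IsIndecomposableModule.of_injective_ringHom (F : Module.End T N →+* Module.End S M)
    (hF : Function.Injective F) (h : IsIndecomposableModule S M) : IsIndecomposableModule T N :=
  h.of_ringHom F fun _ _ => (map_eq_zero_iff F hF).mp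

end Indecomposable

section UniqueExtensions

variable {S D D' T N N' : Type*} [Ring S] [AddCommGroup D] [Module S D] [AddCommGroup D']
  [Module S D'] [Ring T] [AddCommGroup N] [Module T N] [AddCommGroup N'] [Module T N']

variable (S T) in
/-- Every `S`-linear map `D → D'` extends along the additive maps `θ : D → N` and `θ' : D' → N'` to
a unique `T`-linear map `N → N'`. This yields additive functors between categories of modules
without a relation between the rings `S` and `T`, such as `k[G]` and `B * G`. -/
def HasUniqueExtensions (θ : D →+ N) (θ' : D' →+ N') : Prop :=
  ∀ f : D →ₗ[S] D', ∃! ψ : N →ₗ[T] N', ∀ x, ψ (θ x) = θ' (f x)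

namespace HasUniqueExtensions

variable {θ : D →+ N} {θ' : D' →+ N'}

/-- The ring homomorphism `End D → End N` of a map `D → N` along which endomorphisms extend
uniquely. -/
noncomputable def ringHom (h : HasUniqueExtensions S T θ θ) :
    Module.End S D →+* Module.End T N where
  toFun f := (h f).choose
  map_one' := (h 1).unique (h 1).choose_spec.1 fun _ => rfl
  map_zero' := (h 0).unique (h 0).choose_spec.1 fun _ => (map_zero θ).symm
  map_mul' f f' := (h (f * f')).unique (h (f * f')).choose_spec.1 fun x => by
    rw [Module.End.mul_apply, (h f').choose_spec.1, (h f).choose_spec.1, Module.End.mul_apply]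
  map_add' f f' := (h (f + f')).unique (h (f + f')).choose_spec.1 fun x => by
    rw [LinearMap.add_apply, (h f').choose_spec.1, (h f).choose_spec.1, LinearMap.add_apply,
      map_add]

theorem ringHom_apply (h : HasUniqueExtensions S T θ θ) (f : Module.End S D) (x : D) :
    h.ringHom f (θ x) = θ (f x) :=
  (h f).choose_spec.1 x

theorem ringHom_injective (h : HasUniqueExtensions S T θ θ) (hθ : Function.Injective θ) :
    Function.Injective h.ringHom := fun f f' hf =>
  LinearMap.ext fun x => hθ <| by rw [← h.ringHom_apply, hf, h.ringHom_apply]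

theorem isIndecomposableModule (h : HasUniqueExtensions S T θ θ) (hθ : Function.Injective θ)
    (hN : IsIndecomposableModule T N) : IsIndecomposableModule S D :=
  hN.of_injective_ringHom h.ringHom (h.ringHom_injective hθ)

theorem nonempty_linearEquiv (h : HasUniqueExtensions S T θ θ')
    (h' : HasUniqueExtensions S T θ' θ) (hid : HasUniqueExtensions S T θ θ)
    (hid' : HasUniqueExtensions S T θ' θ') (e : D ≃ₗ[S] D') : Nonempty (N ≃ₗ[T] N') := by
  obtain ⟨ψ, hψ, -⟩ := h e
  obtain ⟨ψ', hψ', -⟩ := h' e.symm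
  simp only [LinearEquiv.coe_coe] at hψ hψ'
  refine ⟨LinearEquiv.ofLinearMap ψ ψ' ?_ ?_⟩
  · exact (hid' LinearMap.id).unique (fun x => by simp [hψ, hψ']) fun _ => rfl
  · exact (hid LinearMap.id).unique (fun x => by simp [hψ, hψ']) fun _ => rfl

end HasUniqueExtensions

end UniqueExtensions

section Freeness

variable (G B : Type*) [Group G] [CommRing B] [MulSemiringAction G B]

/-- The `B`-span of the orbit maps `g ↦ g • b` in the algebra of functions `G → B`. It is the image
of `B ⊗ B` over the ring of invariants, and the action is free when it contains all functions. -/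
noncomputable def orbitSpan : Submodule B (G → B) :=
  Submodule.span B (Set.range fun (b : B) (g : G) => g • b)

open Classical in
/-- The ideal of all `s` such that `s` times the indicator function of `1` is a `B`-linear
combination of orbit maps; its zero locus is the locus where the action is not free. -/
noncomputable def freenessIdeal : Ideal B :=
  (orbitSpan G B).comap (LinearMap.single B (fun _ : G => B) 1)

variable {G B}

theorem one_mem_orbitSpan : (1 : G → B) ∈ orbitSpan G B :=
  Submodule.subset_span ⟨1, funext fun g => smul_one g⟩

theorem mul_mem_orbitSpan {f f' : G → B} (hf : f ∈ orbitSpan G B) (hf' : f' ∈ orbitSpan G B) :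
    f * f' ∈ orbitSpan G B := by
  have h := Submodule.mul_mem_mul hf hf'
  rw [orbitSpan, Submodule.span_mul_span] at h
  refine Submodule.span_mono ?_ h
  rintro _ ⟨_, ⟨b, rfl⟩, _, ⟨b', rfl⟩, rfl⟩
  exact ⟨b * b', funext fun g => smul_mul' g b b'⟩

theorem exists_mem_orbitSpan_apply_eq_zero {p : Ideal B} {g : G} (hg : g⁻¹ ∉ p.inertia G) :
    ∃ f ∈ orbitSpan G B, f 1 ∉ p ∧ f g = 0 := by
  obtain ⟨y, hy⟩ : ∃ y, g⁻¹ • y - y ∉ p := not_forall.mp hg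
  refine ⟨y • 1 - fun h => h • g⁻¹ • y, sub_mem (Submodule.smul_mem _ _ one_mem_orbitSpan)
    (Submodule.subset_span ⟨_, rfl⟩), ?_, by simp⟩
  rw [← neg_mem_iff]
  simpa using hy

theorem not_freenessIdeal_le_of_inertia_eq_bot [Finite G] (p : Ideal B) [hp : p.IsPrime]
    (h : p.inertia G = ⊥) : ¬ freenessIdeal G B ≤ p := by
  classical
  have := Fintype.ofFinite G
  have hsep : ∀ g : G, ∃ f ∈ orbitSpan G B, f 1 ∉ p ∧ (g ≠ 1 → f g = 0) := by
    intro g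
    by_cases hg : g = 1
    · exact ⟨1, one_mem_orbitSpan, hp.one_notMem, fun hne => absurd hg hne⟩
    · obtain ⟨f, hf, hf1, hfg⟩ := exists_mem_orbitSpan_apply_eq_zero (p := p) (g := g)
        (by rwa [h, Subgroup.mem_bot, inv_eq_one])
      exact ⟨f, hf, hf1, fun _ => hfg⟩
  choose f hf hf1 hfg using hsep
  have hprod : ∏ g, f g ∈ orbitSpan G B :=
    Finset.prod_induction f (· ∈ orbitSpan G B) (fun _ _ => mul_mem_orbitSpan) one_mem_orbitSpan
      fun g _ => hf g
  have hsingle : ∏ g, f g = Pi.single 1 ((∏ g, f g) 1) := by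
    funext h
    obtain rfl | hh := eq_or_ne h 1
    · simp
    · rw [Pi.single_eq_of_ne hh, Finset.prod_apply]
      exact Finset.prod_eq_zero (Finset.mem_univ h) (hfg h hh)
  intro hle
  have hmem : (∏ g, f g) 1 ∈ p := hle (hsingle ▸ hprod :)
  rw [Finset.prod_apply, Ideal.IsPrime.prod_mem_iff] at hmem
  obtain ⟨g, -, hg⟩ := hmem
  exact hf1 g hg

theorem IsSmallAction.two_le_height_freenessIdeal [Finite G] (h : IsSmallAction G B) :
    2 ≤ (freenessIdeal G B).height := by
  obtain ⟨U, -, hfree, hcodim⟩ := h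
  rw [Ideal.height_eq_inf_minimalPrimes]
  refine le_iInf₂ fun p hp => ?_
  have hprime : p.IsPrime := hp.1.1
  have hpU : (⟨p, hprime⟩ : PrimeSpectrum B) ∉ U := fun hpU =>
    not_freenessIdeal_le_of_inertia_eq_bot p (hfree _ hpU) hp.1.2
  exact hcodim.trans (iInf₂_le (⟨p, hprime⟩ : PrimeSpectrum B) hpU)

end Freeness

section WeaklyRegular

open RingTheory.Sequence

theorem isWeaklyRegular_pair_iff {R M : Type*} [CommRing R] [AddCommGroup M] [Module R M]
    {s t : R} : IsWeaklyRegular M [s, t] ↔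
      IsSMulRegular M s ∧ ∀ x y : M, t • x = s • y → ∃ z, x = s • z := by
  rw [isWeaklyRegular_cons_iff, isWeaklyRegular_singleton_iff]
  refine and_congr_right fun _ => ?_
  rw [isSMulRegular_quotient_iff_mem_of_smul_mem]
  simp only [Submodule.mem_smul_pointwise_iff_exists, Submodule.mem_top, true_and]
  exact ⟨fun h x y hxy => (h x ⟨y, hxy.symm⟩).imp fun _ hz => hz.symm,
    fun h x ⟨y, hxy⟩ => (h x y hxy.symm).imp fun _ hz => hz.symm⟩

theorem isWeaklyRegular_pair_of_isRelPrime {R : Type*} [CommRing R] [IsDomain R]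
    [DecompositionMonoid R] {s t : R} (h : IsRelPrime s t) (hs : s ≠ 0) :
    IsWeaklyRegular R [s, t] := by
  refine isWeaklyRegular_pair_iff.mpr ⟨.of_ne_zero hs, fun x y hxy => ?_⟩
  exact h.dvd_of_dvd_mul_left ⟨y, hxy⟩

theorem isWeaklyRegular_module_of_flat {R : Type*} (M : Type*) [CommRing R] [AddCommGroup M]
    [Module R M] [Module.Flat R M] {rs : List R} (h : IsWeaklyRegular R rs) :
    IsWeaklyRegular M rs :=
  ((TensorProduct.rid R M).isWeaklyRegular_congr rs).mp h.isWeaklyRegular_lTensor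

theorem exists_isWeaklyRegular_pair_of_two_le_height {R : Type*} [CommRing R] [IsDomain R]
    [IsNoetherianRing R] [UniqueFactorizationMonoid R] {J : Ideal R} (hJ : 2 ≤ J.height) :
    ∃ s ∈ J, ∃ t ∈ J, IsWeaklyRegular R [s, t] := by
  classical
  have not_le : ∀ p : Ideal R, p.IsPrime → p.height ≤ 1 → ¬ J ≤ p := fun p _ hp hle =>
    absurd ((hJ.trans (Ideal.height_mono hle)).trans hp) (by decide)
  obtain ⟨s, hs, hs0⟩ := SetLike.not_le_iff_exists.mp (not_le ⊥ inferInstance (by simp))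
  rw [Ideal.mem_bot] at hs0
  have hprime : ∀ q ∈ UniqueFactorizationMonoid.factors s, (Ideal.span {q}).IsPrime := fun q hq =>
    have hq := UniqueFactorizationMonoid.prime_of_factor q hq
    (Ideal.span_singleton_prime hq.ne_zero).mpr hq
  obtain ⟨t, ht, htq⟩ : ∃ t ∈ J, ∀ q ∈ UniqueFactorizationMonoid.factors s, ¬ q ∣ t := by
    by_contra! hcover
    have hsub : (J : Set R) ⊆ ⋃ q ∈ ((UniqueFactorizationMonoid.factors s).toFinset : Set R),
        (Ideal.span {q} : Ideal R) := fun t ht => by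
      simpa [Ideal.mem_span_singleton] using hcover t ht
    rw [Ideal.subset_union_prime 0 0 fun q hq _ _ => hprime q (by simpa using hq)] at hsub
    obtain ⟨q, hq, hle⟩ := hsub
    have hqp := hprime q (by simpa using hq)
    exact not_le _ hqp (Ideal.height_le_one_of_isPrincipal_of_mem_minimalPrimes (Ideal.span {q}) _
      ⟨⟨hqp, le_rfl⟩, fun _ hI _ => hI.2⟩) hle
  have hrel : IsRelPrime s t :=
    (UniqueFactorizationMonoid.isRelPrime_iff_no_prime_factors hs0).mpr fun q hqs hqt hq => by
      obtain ⟨r, hr, hqr⟩ :=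
        UniqueFactorizationMonoid.exists_mem_factors_of_dvd hs0 hq.irreducible hqs
      exact htq r hr (hqr.symm.dvd.trans hqt)
  exact ⟨s, hs, t, ht, isWeaklyRegular_pair_of_isRelPrime hrel hs0⟩

end WeaklyRegular

section Extension

open RingTheory.Sequence

theorem exists_comp_eq_of_isWeaklyRegular {B F N N' : Type*} [CommRing B] [AddCommGroup F]
    [Module B F] [AddCommGroup N] [Module B N] [AddCommGroup N'] [Module B N'] {L : F →ₗ[B] N}
    {L' : F →ₗ[B] N'} (hker : L.ker ≤ L'.ker) {s t : B} (hs : ∀ x : N, s • x ∈ L.range)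
    (ht : ∀ x : N, t • x ∈ L.range) (hst : IsWeaklyRegular N' [s, t]) :
    ∃ ψ : N →ₗ[B] N', ψ ∘ₗ L = L' := by
  obtain ⟨hreg, hdvd⟩ := isWeaklyRegular_pair_iff.mp hst
  let φ : L.range →ₗ[B] N' := L.ker.liftQ L' hker ∘ₗ L.quotKerEquivRange.symm.toLinearMap
  have hφ : ∀ l, φ (L.rangeRestrict l) = L' l := fun l => by
    have h : L.quotKerEquivRange (L.ker.mkQ l) = L.rangeRestrict l := rfl
    simp [φ, ← h]
  let φs : N →ₗ[B] N' := φ ∘ₗ (LinearMap.lsmul B N s).codRestrict L.range hs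
  let φt : N →ₗ[B] N' := φ ∘ₗ (LinearMap.lsmul B N t).codRestrict L.range ht
  have hcomm : ∀ x, t • φs x = s • φt x := fun x =>
    calc t • φs x = φ (t • ⟨s • x, hs x⟩) := (map_smul φ t _).symm
      _ = φ (s • ⟨t • x, ht x⟩) := congrArg φ (Subtype.ext (smul_comm t s x))
      _ = s • φt x := map_smul φ s _
  have hrange : ∀ x, φs x ∈ (LinearMap.lsmul B N' s).range := fun x =>
    (hdvd _ _ (hcomm x)).imp fun _ h => h.symm
  refine ⟨(LinearEquiv.ofInjective (LinearMap.lsmul B N' s) hreg).symm.toLinearMap ∘ₗ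
    φs.codRestrict _ hrange, LinearMap.ext fun l => ?_⟩
  rw [LinearMap.comp_apply, LinearMap.comp_apply, LinearEquiv.coe_coe, LinearEquiv.symm_apply_eq]
  refine Subtype.ext ?_
  calc φ ⟨s • L l, _⟩ = φ (L.rangeRestrict (s • l)) :=
        congrArg φ (Subtype.ext (map_smul L s l).symm)
    _ = s • L' l := by rw [hφ, map_smul]

variable {G A B M N N' : Type*} [Group G] [CommRing B] [MulSemiringAction G B]
  [AddCommGroup N] [Module B N] [DistribMulAction G N] [SMulDistribClass G B N]
  [AddCommGroup N'] [Module B N'] [DistribMulAction G N'] [SMulDistribClass G B N']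

theorem sum_smul_mem_fixedPoints [Fintype G] (x : N) :
    ∑ g : G, g • x ∈ MulAction.fixedPoints G N := fun h => by
  rw [Finset.smul_sum]
  exact Fintype.sum_equiv (Equiv.mulLeft h) _ _ fun g => smul_smul h g x

theorem smul_mem_span_range_sum_smul [Fintype G] {s : B} (hs : s ∈ freenessIdeal G B) (x : N) :
    s • x ∈ Submodule.span B (Set.range fun y : B => ∑ g : G, g • y • x) := by
  classical
  have horbit : ∀ f ∈ orbitSpan G B,
      ∑ g, f g • g • x ∈ Submodule.span B (Set.range fun y : B => ∑ g : G, g • y • x) := by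
    intro f hf
    induction hf using Submodule.span_induction with
    | mem f hf =>
      obtain ⟨y, rfl⟩ := hf
      exact Submodule.subset_span ⟨y, by simp only [smul_distrib_smul]⟩
    | zero => simp
    | add f f' _ _ h h' => simpa [add_smul, Finset.sum_add_distrib] using add_mem h h'
    | smul b f _ h => simpa [mul_smul, Finset.smul_sum] using Submodule.smul_mem _ b h
  have h := horbit _ hs
  rw [Fintype.sum_eq_single (1 : G) fun g hg => by simp [Pi.single_eq_of_ne hg]] at h
  simpa using h

theorem smul_mem_span_fixedPoints [Finite G] {s : B} (hs : s ∈ freenessIdeal G B) (x : N) :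
    s • x ∈ Submodule.span B (MulAction.fixedPoints G N) := by
  have := Fintype.ofFinite G
  refine Submodule.span_mono ?_ (smul_mem_span_range_sum_smul hs x)
  rintro _ ⟨y, rfl⟩
  exact sum_smul_mem_fixedPoints _

theorem linearMap_eq_of_eqOn_fixedPoints {P : Type*} [AddCommGroup P] [Module B P] [Finite G]
    {s : B} (hs : s ∈ freenessIdeal G B) (hreg : IsSMulRegular P s) {ψ ψ' : N →ₗ[B] P}
    (h : Set.EqOn ψ ψ' (MulAction.fixedPoints G N)) : ψ = ψ' :=
  LinearMap.ext fun x => hreg <| by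
    change s • ψ x = s • ψ' x
    rw [← map_smul, ← map_smul]
    exact LinearMap.eqOn_span h (smul_mem_span_fixedPoints hs x)

theorem map_smul_of_mapsTo_fixedPoints [Finite G] {s : B} (hs : s ∈ freenessIdeal G B)
    (hreg : IsSMulRegular N' s) {ψ : N →ₗ[B] N'}
    (h : Set.MapsTo ψ (MulAction.fixedPoints G N) (MulAction.fixedPoints G N')) (g : G) (x : N) :
    ψ (g • x) = g • ψ x := by
  let ψg : N →ₗ[B] N' :=
    { toFun := fun x => g⁻¹ • ψ (g • x)
      map_add' := fun x y => by simp only [smul_add, map_add]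
      map_smul' := fun b x => by
        rw [smul_distrib_smul, map_smul, smul_distrib_smul, inv_smul_smul, RingHom.id_apply] }
  have hψg : ψg = ψ := linearMap_eq_of_eqOn_fixedPoints hs hreg fun x hx => by
    change g⁻¹ • ψ (g • x) = ψ x
    rw [hx g, h hx g⁻¹]
  have hx : g⁻¹ • ψ (g • x) = ψ x := LinearMap.congr_fun hψg x
  exact inv_smul_eq_iff.mp hx

variable [CommRing A] [Algebra A B] [Algebra.IsInvariant A B G] [AddCommGroup M] [Module A M]
  [Module A N] [IsScalarTower A B N] [Module A N'] [IsScalarTower A B N']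

variable (B) in
theorem exists_apply_eq_sum_smul_linearCombination [Fintype G] {i : M →ₗ[A] N} {φ : M →ₗ[A] N'}
    (hi : ∀ z (g : G), g • i z = i z) (hφ : ∀ z (g : G), g • φ z = φ z) (l : M →₀ B) :
    ∃ m, i m = ∑ g : G, g • Finsupp.linearCombination B i l ∧
      φ m = ∑ g : G, g • Finsupp.linearCombination B φ l := by
  induction l using Finsupp.induction_linear with
  | zero => exact ⟨0, by simp⟩
  | add l l' h h' =>
    obtain ⟨m, hm⟩ := h
    obtain ⟨m', hm'⟩ := h'
    exact ⟨m + m', by simp [hm, hm', Finset.sum_add_distrib]⟩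
  | single z b =>
    obtain ⟨a, ha⟩ := Algebra.IsInvariant.isInvariant (A := A) (G := G) (∑ g : G, g • b)
      (sum_smul_mem_fixedPoints b)
    refine ⟨a • z, ?_, ?_⟩
    all_goals simp [smul_distrib_smul, hi, hφ, ← Finset.sum_smul, ← ha]

theorem ker_linearCombination_le_ker_linearCombination [Finite G] {i : M →ₗ[A] N}
    {φ : M →ₗ[A] N'} (hinj : Function.Injective i) (hi : ∀ z (g : G), g • i z = i z)
    (hφ : ∀ z (g : G), g • φ z = φ z) {s : B} (hs : s ∈ freenessIdeal G B)
    (hreg : IsSMulRegular N' s) :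
    (Finsupp.linearCombination B i).ker ≤ (Finsupp.linearCombination B φ).ker := fun l hl => by
  have := Fintype.ofFinite G
  have htrace : ∀ y : B, ∑ g : G, g • y • Finsupp.linearCombination B φ l = 0 := fun y => by
    obtain ⟨m, hm, hm'⟩ := exists_apply_eq_sum_smul_linearCombination B hi hφ (y • l)
    rw [map_smul, LinearMap.mem_ker.mp hl, smul_zero] at hm
    rw [← map_smul, ← hm', hinj (a₁ := m) (a₂ := 0) (by simpa using hm), map_zero]
  have h := smul_mem_span_range_sum_smul hs (Finsupp.linearCombination B φ l)
  simp only [htrace, Set.range_const, Submodule.span_zero_singleton, Submodule.mem_bot] at h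
  exact hreg (h.trans (smul_zero s).symm)

theorem exists_equivariant_extension [Finite G] {i : M →ₗ[A] N} {φ : M →ₗ[A] N'}
    (hinj : Function.Injective i) (hi : Set.range i = MulAction.fixedPoints G N)
    (hφ : ∀ z (g : G), g • φ z = φ z) {s t : B} (hs : s ∈ freenessIdeal G B)
    (ht : t ∈ freenessIdeal G B) (hst : IsWeaklyRegular N' [s, t]) :
    ∃ ψ : N →ₗ[B] N', (∀ z, ψ (i z) = φ z) ∧ ∀ (g : G) x, ψ (g • x) = g • ψ x := by
  have hreg : IsSMulRegular N' s := (isWeaklyRegular_pair_iff.mp hst).1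
  have hfixed : ∀ z (g : G), g • i z = i z := fun z => hi.subset ⟨z, rfl⟩
  have hrange : ∀ r ∈ freenessIdeal G B, ∀ x : N, r • x ∈ (Finsupp.linearCombination B i).range :=
    fun r hr x => by
      rw [Finsupp.range_linearCombination, hi]
      exact smul_mem_span_fixedPoints hr x
  have hker := ker_linearCombination_le_ker_linearCombination hinj hfixed hφ hs hreg
  obtain ⟨ψ, hψ⟩ := exists_comp_eq_of_isWeaklyRegular hker (hrange s hs) (hrange t ht) hst
  have hψi : ∀ z, ψ (i z) = φ z := fun z => by
    simpa using LinearMap.congr_fun hψ (Finsupp.single z 1)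
  refine ⟨ψ, hψi, map_smul_of_mapsTo_fixedPoints hs hreg fun x hx => ?_⟩
  obtain ⟨z, rfl⟩ := hi.superset hx
  exact fun g => by rw [hψi, hφ]

end Extension

section AdicGeneralities

variable {R M M' N : Type*} [CommRing R] {J : Ideal R} [AddCommGroup M] [Module R M]
  [AddCommGroup M'] [Module R M'] [AddCommGroup N] [Module R N]

theorem eq_zero_of_isIdempotentElem_of_range_le_smul_top [IsHausdorff J M] {e : Module.End R M}
    (he : IsIdempotentElem e) (hrange : e.range ≤ J • ⊤) : e = 0 := by
  have hpow : ∀ n : ℕ, e.range ≤ J ^ n • ⊤ := fun n => by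
    induction n with
    | zero => simp
    | succ n ih =>
      calc e.range = (e.range).map e := by
            rw [← LinearMap.range_comp, ← Module.End.mul_eq_comp, he.eq]
        _ ≤ J ^ n • e.range := by
            rw [← Submodule.map_top e, ← Submodule.map_smul'', Submodule.map_top]
            exact Submodule.map_mono ih
        _ ≤ J ^ (n + 1) • ⊤ := by
            rw [pow_succ, mul_smul]
            exact Submodule.smul_mono le_rfl hrange
  rw [← LinearMap.range_eq_bot, eq_bot_iff, ← IsHausdorff.iInf_pow_smul ‹IsHausdorff J M›]
  exact le_iInf hpow

theorem isHausdorff_of_injective {f : M →ₗ[R] N} (hf : Function.Injective f) [IsHausdorff J N] :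
    IsHausdorff J M where
  haus' x hx := (map_eq_zero_iff f hf).mp <| IsHausdorff.haus ‹_› _ fun n => by
    rw [SModEq.zero]
    have h := Submodule.mem_map_of_mem (f := f) (SModEq.zero.mp (hx n))
    rw [Submodule.map_smul''] at h
    exact Submodule.smul_mono le_rfl le_top h

theorem isHausdorff_pi {ι : Type*} {X : ι → Type*} [∀ i, AddCommGroup (X i)] [∀ i, Module R (X i)]
    [∀ i, IsHausdorff J (X i)] : IsHausdorff J (∀ i, X i) where
  haus' x hx := funext fun i => IsHausdorff.haus (I := J) inferInstance _ fun n => by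
    rw [SModEq.zero]
    have h := Submodule.mem_map_of_mem (f := LinearMap.proj (R := R) i) (SModEq.zero.mp (hx n))
    rw [Submodule.map_smul''] at h
    exact Submodule.smul_mono le_rfl le_top h

theorem isHausdorff_of_free [Module.Free R M] [Module.Finite R M] [IsHausdorff J R] :
    IsHausdorff J M :=
  have : IsHausdorff J (Module.Free.ChooseBasisIndex R M → R) := isHausdorff_pi
  isHausdorff_of_injective (Module.Free.chooseBasis R M).equivFun.injective

theorem adicCompletion_hom_ext [IsHausdorff J N] (hJ : J.FG) {f f' : AdicCompletion J M →ₗ[R] N}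
    (h : ∀ x, f (AdicCompletion.of J M x) = f' (AdicCompletion.of J M x)) : f = f' := by
  refine sub_eq_zero.mp <| LinearMap.ext fun x => IsHausdorff.haus ‹IsHausdorff J N› _ fun n => ?_
  obtain ⟨z, hz⟩ := Submodule.mkQ_surjective _ (AdicCompletion.eval J M n x)
  have hxz : x - AdicCompletion.of J M z ∈ J ^ n • (⊤ : Submodule R (AdicCompletion J M)) := by
    rw [AdicCompletion.pow_smul_top_eq_ker_eval hJ, LinearMap.mem_ker, map_sub,
      AdicCompletion.eval_of, hz, sub_self]
  have hmem := Submodule.mem_map_of_mem (f := f - f') hxz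
  rw [Submodule.map_smul'', map_sub, LinearMap.sub_apply _ _ (AdicCompletion.of J M z), h z,
    sub_self, sub_zero] at hmem
  rw [SModEq.zero]
  exact Submodule.smul_mono le_rfl le_top hmem

theorem hasUniqueExtensions_adicCompletion (hJ : J.FG) :
    HasUniqueExtensions R (AdicCompletion J R) (AdicCompletion.of J M).toAddMonoidHom
      (AdicCompletion.of J M').toAddMonoidHom := fun f => by
  refine ⟨AdicCompletion.map J f, AdicCompletion.map_of J f, fun ψ hψ => ?_⟩
  have h : ψ.restrictScalars R = (AdicCompletion.map J f).restrictScalars R :=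
    adicCompletion_hom_ext hJ fun x => (hψ x).trans (AdicCompletion.map_of J f x).symm
  exact LinearMap.ext fun x => LinearMap.congr_fun h x

end AdicGeneralities

section ChangeOfIdeal

variable {A B : Type*} [CommRing A] [CommRing B] [Algebra A B] {J : Ideal A} {I : Ideal B}
  {N : Type*} [AddCommGroup N] [Module A N] [Module B N] [IsScalarTower A B N]

theorem mem_map_pow_smul_top_iff {n : ℕ} {x : N} :
    x ∈ (J.map (algebraMap A B) ^ n • ⊤ : Submodule B N) ↔ x ∈ (J ^ n • ⊤ : Submodule A N) := by
  rw [← Submodule.restrictScalars_top A B N, ← Submodule.restrictScalars_map_smul_eq, Ideal.map_pow,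
    Submodule.restrictScalars_mem]

variable (N) in
/-- The map on the `n`-th quotients underlying `adicCompletionMapOfLE`. -/
noncomputable def quotientPowMapOfLE (h : J.map (algebraMap A B) ≤ I) (n : ℕ) :
    N ⧸ (J ^ n • ⊤ : Submodule A N) →ₗ[A] N ⧸ (I ^ n • ⊤ : Submodule B N) :=
  (J ^ n • ⊤ : Submodule A N).liftQ ((I ^ n • ⊤ : Submodule B N).mkQ.restrictScalars A)
    fun x hx => by
      rw [← mem_map_pow_smul_top_iff (B := B)] at hx
      rw [LinearMap.mem_ker, LinearMap.restrictScalars_apply, Submodule.mkQ_apply,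
        Submodule.Quotient.mk_eq_zero]
      exact Submodule.smul_mono (Ideal.pow_right_mono h n) le_rfl hx

theorem quotientPowMapOfLE_mk (h : J.map (algebraMap A B) ≤ I) (n : ℕ) (x : N) :
    quotientPowMapOfLE N h n (Submodule.Quotient.mk x) = Submodule.Quotient.mk x :=
  Submodule.liftQ_apply _ _ x

variable (N) in
/-- For a module over an `A`-algebra `B`, the map from the completion along an ideal of `A` to the
completion along an ideal of `B` that contains its image. -/
noncomputable def adicCompletionMapOfLE (h : J.map (algebraMap A B) ≤ I) :
    AdicCompletion J N →ₗ[A] AdicCompletion I N where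
  toFun x := ⟨fun n => quotientPowMapOfLE N h n (x.val n), fun {m n} hmn => by
    obtain ⟨z, hz⟩ := Submodule.Quotient.mk_surjective _ (x.val n)
    have hm : x.val m = Submodule.Quotient.mk z := by
      rw [← AdicCompletion.transitionMap_comp_eval_apply J N hmn x, ← hz]
      rfl
    beta_reduce
    rw [hm, ← hz, quotientPowMapOfLE_mk, quotientPowMapOfLE_mk]
    rfl⟩
  map_add' x y := AdicCompletion.ext fun n => map_add (quotientPowMapOfLE N h n) (x.val n) (y.val n)
  map_smul' a x := AdicCompletion.ext fun n => map_smul (quotientPowMapOfLE N h n) a (x.val n)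

theorem adicCompletionMapOfLE_of (h : J.map (algebraMap A B) ≤ I) (x : N) :
    adicCompletionMapOfLE N h (AdicCompletion.of J N x) = AdicCompletion.of I N x :=
  AdicCompletion.ext fun n => quotientPowMapOfLE_mk h n x

theorem adicCompletionMapOfLE_injective (h : J.map (algebraMap A B) ≤ I) {r : ℕ}
    (hr : I ^ r ≤ J.map (algebraMap A B)) :
    Function.Injective (adicCompletionMapOfLE N h) := by
  rw [← LinearMap.ker_eq_bot, LinearMap.ker_eq_bot']
  intro x hx
  induction x using AdicCompletion.induction_on with
  | _ a =>
    refine AdicCompletion.mk_zero_of J N a ⟨0, fun n _ => ⟨r * n + n, by lia, n, le_rfl, ?_⟩⟩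
    have hmem : a (r * n + n) ∈ (I ^ (r * n + n) • ⊤ : Submodule B N) :=
      (Submodule.Quotient.mk_eq_zero _).mp (congrArg (fun y => y.val (r * n + n)) hx)
    refine mem_map_pow_smul_top_iff.mp (Submodule.smul_mono ?_ le_rfl hmem)
    calc I ^ (r * n + n) ≤ (I ^ r) ^ n := by
          rw [← pow_mul]
          exact Ideal.pow_le_pow_right le_self_add
      _ ≤ J.map (algebraMap A B) ^ n := Ideal.pow_right_mono hr n

end ChangeOfIdeal

namespace TwistedTensor

variable {k G V V' : Type*} [Field k] [Group G] [AddCommGroup V] [Module k V]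
  [AddCommGroup V'] [Module k V']
  {C : Type*} [CommRing C] [Algebra k C]
  {ρ : Representation k G V} {ρ' : Representation k G V'}

section Tensors

variable (C ρ) in
/-- The pure tensor `c ⊗ v`, as an element of the type synonym `TwistedTensor C ρ`. -/
def tmul (c : C) (v : V) : TwistedTensor C ρ := c ⊗ₜ[k] v

@[elab_as_elim]
theorem induction_on {p : TwistedTensor C ρ → Prop} (x : TwistedTensor C ρ)
    (tmul : ∀ c v, p (tmul C ρ c v)) (add : ∀ x y, p x → p y → p (x + y)) : p x := by
  have hzero : TwistedTensor.tmul C ρ 0 0 = 0 := TensorProduct.zero_tmul C (0 : V)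
  exact TensorProduct.induction_on (motive := p) x (hzero ▸ tmul 0 0) tmul add

theorem smul_tmul (a c : C) (v : V) : a • tmul C ρ c v = tmul C ρ (a * c) v := rfl

theorem tmul_eq_smul (c : C) (v : V) : tmul C ρ c v = c • tmul C ρ 1 v := by
  rw [smul_tmul, mul_one]

instance : Module.Free C (TwistedTensor C ρ) := inferInstanceAs (Module.Free C (C ⊗[k] V))

instance [FiniteDimensional k V] : Module.Finite C (TwistedTensor C ρ) :=
  inferInstanceAs (Module.Finite C (C ⊗[k] V))

variable (C ρ) in
/-- The map `v ↦ 1 ⊗ v`. -/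
noncomputable def inclusion : V →ₗ[k] TwistedTensor C ρ := TensorProduct.mk k C V 1

theorem inclusion_apply (v : V) : inclusion C ρ v = tmul C ρ 1 v := rfl

theorem linearMap_ext {P : Type*} [AddCommGroup P] [Module C P]
    {f f' : TwistedTensor C ρ →ₗ[C] P} (h : ∀ v, f (inclusion C ρ v) = f' (inclusion C ρ v)) :
    f = f' := by
  refine LinearMap.ext fun x => ?_
  induction x using TwistedTensor.induction_on with
  | tmul c v => rw [tmul_eq_smul, map_smul, map_smul, ← inclusion_apply, h]
  | add x y hx hy => rw [map_add, map_add, hx, hy]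

variable (C ρ) in
/-- The map `v ↦ 1 ⊗ v` on the `kG`-module of a representation. -/
noncomputable def asModuleInclusion : ρ.asModule →+ TwistedTensor C ρ :=
  (inclusion C ρ).toAddMonoidHom.comp ρ.asModuleEquiv.toAddMonoidHom

variable (C ρ) in
theorem asModuleInclusion_injective [Nontrivial C] :
    Function.Injective (asModuleInclusion C ρ) :=
  (Module.FaithfullyFlat.tensorProduct_mk_injective (A := k) (B := C) V).comp
    ρ.asModuleEquiv.injective

variable (ε : C →ₐ[k] k)

/-- The reduction `C ⊗ V → V` along an augmentation of `C`. -/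
noncomputable def reduction (ρ : Representation k G V) : TwistedTensor C ρ →ₗ[k] V :=
  (TensorProduct.lid k V).toLinearMap ∘ₗ LinearMap.rTensor V ε.toLinearMap

theorem reduction_tmul (c : C) (v : V) : reduction ε ρ (tmul C ρ c v) = ε c • v := rfl

theorem reduction_inclusion (v : V) : reduction ε ρ (inclusion C ρ v) = v := by
  rw [inclusion_apply, reduction_tmul, map_one, one_smul]

theorem reduction_smul (c : C) (x : TwistedTensor C ρ) :
    reduction ε ρ (c • x) = ε c • reduction ε ρ x := by
  induction x using TwistedTensor.induction_on with
  | tmul c' v => rw [smul_tmul, reduction_tmul, reduction_tmul, map_mul, mul_smul]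
  | add x y hx hy => rw [smul_add, map_add, hx, hy, map_add, smul_add]

theorem sub_inclusion_reduction_mem (x : TwistedTensor C ρ) :
    x - inclusion C ρ (reduction ε ρ x) ∈
      RingHom.ker ε • (⊤ : Submodule C (TwistedTensor C ρ)) := by
  induction x using TwistedTensor.induction_on with
  | tmul c v =>
    have h : tmul C ρ c v - inclusion C ρ (reduction ε ρ (tmul C ρ c v)) =
        (c - algebraMap k C (ε c)) • tmul C ρ 1 v := by
      rw [reduction_tmul, map_smul, sub_smul, inclusion_apply, ← tmul_eq_smul, algebraMap_smul]
    rw [h]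
    refine Submodule.smul_mem_smul ?_ trivial
    rw [RingHom.mem_ker, map_sub, AlgHom.commutes, Algebra.algebraMap_self_apply, sub_self]
  | add x y hx hy =>
    rw [map_add, map_add, add_sub_add_comm]
    exact add_mem hx hy

/-- The reduction `C ⊗ V → V` with values in the `kG`-module of the representation. -/
noncomputable def asModuleReduction (ρ : Representation k G V) : TwistedTensor C ρ →+ ρ.asModule :=
  ρ.asModuleEquiv.symm.toAddMonoidHom.comp (reduction ε ρ).toAddMonoidHom

theorem asModuleReduction_surjective : Function.Surjective (asModuleReduction ε ρ) :=
  ρ.asModuleEquiv.symm.surjective.comp fun v => ⟨inclusion C ρ v, reduction_inclusion (ρ := ρ) ε v⟩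

end Tensors

variable [MulSemiringAction G C] [SMulCommClass G k C]

section Action

noncomputable instance : DistribMulAction G (TwistedTensor C ρ) where
  smul g x := diag C ρ g x
  one_smul x := LinearMap.congr_fun (map_one (diag C ρ)) x
  mul_smul g h x := LinearMap.congr_fun (map_mul (diag C ρ) g h) x
  smul_zero g := map_zero (diag C ρ g)
  smul_add g := map_add (diag C ρ g)

theorem smul_eq_diag (g : G) (x : TwistedTensor C ρ) : g • x = diag C ρ g x := rfl

instance : SMulDistribClass G C (TwistedTensor C ρ) where
  smul_distrib_smul := diag_smul C ρ

instance : SMulCommClass G k (TwistedTensor C ρ) where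
  smul_comm g c x := map_smul (diag C ρ g) c x

theorem group_smul_tmul (g : G) (c : C) (v : V) :
    g • tmul C ρ c v = tmul C ρ (g • c) (ρ g v) := rfl

theorem inclusion_group_smul (g : G) (v : V) : inclusion C ρ (ρ g v) = g • inclusion C ρ v := by
  rw [inclusion_apply, inclusion_apply, group_smul_tmul, smul_one]

theorem mem_invariants {x : TwistedTensor C ρ} : x ∈ invariants C ρ ↔ ∀ g : G, g • x = x :=
  Iff.rfl

end Action

section SkewLinear

theorem map_smul_of_skewLinear
    (ψ : TwistedTensor C ρ →ₗ[SkewMonoidAlgebra C G] TwistedTensor C ρ') (c : C)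
    (x : TwistedTensor C ρ) : ψ (c • x) = c • ψ x := by
  simpa only [single_smul, map_one, Module.End.one_apply] using
    map_smul ψ (SkewMonoidAlgebra.single 1 c) x

theorem map_group_smul_of_skewLinear
    (ψ : TwistedTensor C ρ →ₗ[SkewMonoidAlgebra C G] TwistedTensor C ρ') (g : G)
    (x : TwistedTensor C ρ) : ψ (g • x) = g • ψ x := by
  simpa only [single_smul, one_smul, smul_eq_diag] using map_smul ψ (SkewMonoidAlgebra.single g 1) x

/-- The `C`-linear map underlying a map that is linear over the twisted group algebra `C * G`. -/
noncomputable def toLinearMap (ψ : TwistedTensor C ρ →ₗ[SkewMonoidAlgebra C G] TwistedTensor C ρ') :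
    TwistedTensor C ρ →ₗ[C] TwistedTensor C ρ' where
  toFun := ψ
  map_add' := map_add ψ
  map_smul' := map_smul_of_skewLinear ψ

/-- A `G`-equivariant `C`-linear map, as a map linear over the twisted group algebra `C * G`. -/
noncomputable def ofEquivariant (ψ : TwistedTensor C ρ →ₗ[C] TwistedTensor C ρ')
    (hψ : ∀ (g : G) x, ψ (g • x) = g • ψ x) :
    TwistedTensor C ρ →ₗ[SkewMonoidAlgebra C G] TwistedTensor C ρ' where
  toFun := ψ
  map_add' := map_add ψ
  map_smul' a x := by
    rw [RingHom.id_apply]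
    induction a using SkewMonoidAlgebra.induction_on with
    | zero => simp only [zero_smul, map_zero]
    | single g c =>
      rw [single_smul, single_smul, map_smul, ← smul_eq_diag, ← smul_eq_diag, hψ]
    | add a b ha hb => simp only [add_smul, map_add, ha, hb]

theorem skewLinear_ext
    {ψ ψ' : TwistedTensor C ρ →ₗ[SkewMonoidAlgebra C G] TwistedTensor C ρ'}
    (h : ∀ v, ψ (inclusion C ρ v) = ψ' (inclusion C ρ v)) : ψ = ψ' := by
  have heq : toLinearMap ψ = toLinearMap ψ' := linearMap_ext h
  exact LinearMap.ext fun x => LinearMap.congr_fun heq x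

end SkewLinear

section Lift

/-- The map `c ⊗ v ↦ c • h v` defined by an equivariant map `h`. -/
noncomputable def lift (h : V →ₗ[k] TwistedTensor C ρ') (hh : ∀ g v, h (ρ g v) = g • h v) :
    TwistedTensor C ρ →ₗ[SkewMonoidAlgebra C G] TwistedTensor C ρ' :=
  let ψ : TwistedTensor C ρ →ₗ[C] TwistedTensor C ρ' := h.liftBaseChange C
  have hψ : ∀ c v, ψ (tmul C ρ c v) = c • h v := LinearMap.liftBaseChange_tmul C h
  ofEquivariant ψ fun g x => by
    induction x using TwistedTensor.induction_on with
    | tmul c v => rw [group_smul_tmul, hψ, hψ, hh, smul_distrib_smul g c]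
    | add x y hx hy => rw [smul_add, map_add, map_add, smul_add, hx, hy]

theorem lift_inclusion (h : V →ₗ[k] TwistedTensor C ρ') (hh : ∀ g v, h (ρ g v) = g • h v) (v : V) :
    lift h hh (inclusion C ρ v) = h v :=
  (LinearMap.liftBaseChange_tmul C h 1 v).trans (one_smul C _)

variable (C ρ ρ') in
theorem hasUniqueExtensions_asModuleInclusion :
    HasUniqueExtensions (MonoidAlgebra k G) (SkewMonoidAlgebra C G) (asModuleInclusion C ρ)
      (asModuleInclusion C ρ') := fun f => by
  let φ : ρ.IntertwiningMap ρ' :=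
    (Representation.IntertwiningMap.equivLinearMapAsModule ρ ρ').symm f
  have hφ : ∀ g v, inclusion C ρ' (φ (ρ g v)) = g • inclusion C ρ' (φ v) := fun g v => by
    rw [φ.isIntertwining _ _, inclusion_group_smul]
  let h : V →ₗ[k] TwistedTensor C ρ' := inclusion C ρ' ∘ₗ φ.toLinearMap
  refine ⟨lift h hφ, lift_inclusion h hφ, fun ψ hψ => ?_⟩
  exact skewLinear_ext fun v => (hψ v).trans (lift_inclusion h hφ v).symm

variable (C) in
theorem nonempty_linearEquiv_of_asModule (e : ρ.asModule ≃ₗ[MonoidAlgebra k G] ρ'.asModule) :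
    Nonempty (TwistedTensor C ρ ≃ₗ[SkewMonoidAlgebra C G] TwistedTensor C ρ') :=
  (hasUniqueExtensions_asModuleInclusion C ρ ρ').nonempty_linearEquiv
    (hasUniqueExtensions_asModuleInclusion C ρ' ρ) (hasUniqueExtensions_asModuleInclusion C ρ ρ)
    (hasUniqueExtensions_asModuleInclusion C ρ' ρ') e

end Lift

section Reduction

variable (ε : C →ₐ[k] k)

theorem reduction_group_smul (hε : ∀ (g : G) c, ε (g • c) = ε c) (g : G)
    (x : TwistedTensor C ρ) : reduction ε ρ (g • x) = ρ g (reduction ε ρ x) := by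
  induction x using TwistedTensor.induction_on with
  | tmul c v => rw [group_smul_tmul, reduction_tmul, reduction_tmul, hε, map_smul]
  | add x y hx hy => rw [smul_add, map_add, hx, hy, map_add, map_add]

theorem reduction_skewLinear
    (ψ : TwistedTensor C ρ →ₗ[SkewMonoidAlgebra C G] TwistedTensor C ρ')
    (x : TwistedTensor C ρ) :
    reduction ε ρ' (ψ x) = reduction ε ρ' (ψ (inclusion C ρ (reduction ε ρ x))) := by
  induction x using TwistedTensor.induction_on with
  | tmul c v =>
    have h : inclusion C ρ (ε c • v) = algebraMap k C (ε c) • tmul C ρ 1 v := by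
      rw [map_smul, inclusion_apply, algebraMap_smul]
    rw [reduction_tmul, h, tmul_eq_smul, map_smul_of_skewLinear, map_smul_of_skewLinear,
      reduction_smul, reduction_smul, AlgHom.commutes, Algebra.algebraMap_self_apply]
  | add x y hx hy => simp only [map_add, hx, hy]

/-- The map of representations induced by a map of twisted tensor products through reduction along
an invariant augmentation. -/
noncomputable def reductionMap (hε : ∀ (g : G) c, ε (g • c) = ε c)
    (ψ : TwistedTensor C ρ →ₗ[SkewMonoidAlgebra C G] TwistedTensor C ρ') :
    ρ.IntertwiningMap ρ' where
  toLinearMap := reduction ε ρ' ∘ₗ (toLinearMap ψ).restrictScalars k ∘ₗ inclusion C ρ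
  isIntertwining' g := LinearMap.ext fun v => by
    change reduction ε ρ' (ψ (inclusion C ρ (ρ g v))) = ρ' g (reduction ε ρ' (ψ _))
    rw [inclusion_group_smul, map_group_smul_of_skewLinear, reduction_group_smul ε hε]

variable (ρ ρ') in
theorem hasUniqueExtensions_asModuleReduction (hε : ∀ (g : G) c, ε (g • c) = ε c) :
    HasUniqueExtensions (SkewMonoidAlgebra C G) (MonoidAlgebra k G) (asModuleReduction ε ρ)
      (asModuleReduction ε ρ') := fun ψ =>
  ⟨Representation.IntertwiningMap.equivLinearMapAsModule ρ ρ' (reductionMap ε hε ψ),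
    fun x => (reduction_skewLinear ε ψ x).symm, fun f hf => LinearMap.ext fun v => by
      obtain ⟨x, rfl⟩ := asModuleReduction_surjective ε v
      exact (hf x).trans (reduction_skewLinear ε ψ x)⟩

theorem nonempty_asModule_linearEquiv (hε : ∀ (g : G) c, ε (g • c) = ε c)
    (e : TwistedTensor C ρ ≃ₗ[SkewMonoidAlgebra C G] TwistedTensor C ρ') :
    Nonempty (ρ.asModule ≃ₗ[MonoidAlgebra k G] ρ'.asModule) :=
  (hasUniqueExtensions_asModuleReduction ρ ρ' ε hε).nonempty_linearEquiv
    (hasUniqueExtensions_asModuleReduction ρ' ρ ε hε)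
    (hasUniqueExtensions_asModuleReduction ρ ρ ε hε)
    (hasUniqueExtensions_asModuleReduction ρ' ρ' ε hε) e

theorem eq_zero_of_isIdempotentElem_of_reduction_eq_zero [FiniteDimensional k V]
    [IsHausdorff (RingHom.ker ε) C]
    {e : Module.End (SkewMonoidAlgebra C G) (TwistedTensor C ρ)} (he : IsIdempotentElem e)
    (hred : ∀ x, reduction ε ρ (e x) = 0) : e = 0 := by
  have : IsHausdorff (RingHom.ker ε) (TwistedTensor C ρ) := isHausdorff_of_free
  have hidem : IsIdempotentElem (toLinearMap e) :=
    LinearMap.ext fun x => LinearMap.congr_fun he x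
  have hrange : (toLinearMap e).range ≤ RingHom.ker ε • ⊤ := by
    rintro _ ⟨x, rfl⟩
    have h := sub_inclusion_reduction_mem ε (e x)
    rwa [hred, map_zero, sub_zero] at h
  have hzero : toLinearMap e = 0 := eq_zero_of_isIdempotentElem_of_range_le_smul_top hidem hrange
  exact LinearMap.ext fun x => LinearMap.congr_fun hzero x

theorem isIndecomposableModule_of_asModule [FiniteDimensional k V]
    [IsHausdorff (RingHom.ker ε) C] (hε : ∀ (g : G) c, ε (g • c) = ε c)
    (h : IsIndecomposableModule (MonoidAlgebra k G) ρ.asModule) :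
    IsIndecomposableModule (SkewMonoidAlgebra C G) (TwistedTensor C ρ) := by
  have hext := hasUniqueExtensions_asModuleReduction ρ ρ ε hε
  refine h.of_ringHom hext.ringHom fun e he hzero =>
    eq_zero_of_isIdempotentElem_of_reduction_eq_zero ε he fun x => ?_
  have hx := hext.ringHom_apply e x
  rw [hzero] at hx
  exact hx.symm

end Reduction

end TwistedTensor

instance isInvariant_fixedPoints (k B G : Type*) [CommRing k] [CommRing B] [Algebra k B] [Group G]
    [MulSemiringAction G B] [SMulCommClass G k B] :
    Algebra.IsInvariant (FixedPoints.subalgebra k B G) B G where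
  isInvariant b hb := ⟨⟨b, hb⟩, rfl⟩

namespace TwistedTensor

open RingTheory.Sequence

variable {k G V V' B C : Type*} [Field k] [Group G] [AddCommGroup V] [Module k V]
  [AddCommGroup V'] [Module k V']
  [CommRing B] [Algebra k B] [CommRing C] [Algebra k C] [Algebra B C] [IsScalarTower k B C]
  {ρ : Representation k G V} {ρ' : Representation k G V'}

section ExtendScalars

variable (B C ρ) in
/-- The canonical map `B ⊗ V → C ⊗ V` for a `B`-algebra `C`. -/
noncomputable def extendScalars [Module B (TwistedTensor C ρ)]
    [IsScalarTower B C (TwistedTensor C ρ)] : TwistedTensor B ρ →ₗ[B] TwistedTensor C ρ :=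
  let f : TwistedTensor B ρ →ₗ[k] TwistedTensor C ρ :=
    LinearMap.rTensor V (IsScalarTower.toAlgHom k B C).toLinearMap
  { f with
    map_smul' := fun b x => by
      change f (b • x) = b • f x
      rw [algebra_compatible_smul C b (f x)]
      induction x using TwistedTensor.induction_on with
      | tmul c v => exact congrArg (tmul C ρ · v) (map_mul (algebraMap B C) b c)
      | add x y hx hy => rw [smul_add, map_add, hx, hy, map_add, smul_add] }

theorem extendScalars_inclusion [Module B (TwistedTensor C ρ)]
    [IsScalarTower B C (TwistedTensor C ρ)] (v : V) :
    extendScalars B C ρ (inclusion B ρ v) = inclusion C ρ v :=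
  congrArg (tmul C ρ · v) (map_one (algebraMap B C))

theorem extendScalars_tmul [Module B (TwistedTensor C ρ)]
    [IsScalarTower B C (TwistedTensor C ρ)] (b : B) (v : V) :
    extendScalars B C ρ (tmul B ρ b v) = tmul C ρ (algebraMap B C b) v := rfl

end ExtendScalars

variable [MulSemiringAction G B] [SMulCommClass G k B]

section MapInvariants

/-- The map of invariants induced by a map of twisted tensor products. -/
noncomputable def mapInvariants
    (ψ : TwistedTensor B ρ →ₗ[SkewMonoidAlgebra B G] TwistedTensor B ρ') :
    invariants B ρ →ₗ[FixedPoints.subalgebra k B G] invariants B ρ' :=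
  ((toLinearMap ψ).restrictScalars (FixedPoints.subalgebra k B G)).restrict fun x hx g => by
    change g • ψ x = ψ x
    rw [← map_group_smul_of_skewLinear, mem_invariants.mp hx]

variable (ρ) in
/-- The ring homomorphism `End (B ⊗ V) → End (B ⊗ V)^G` of restriction to invariants. -/
noncomputable def endInvariants : Module.End (SkewMonoidAlgebra B G) (TwistedTensor B ρ) →+*
    Module.End (FixedPoints.subalgebra k B G) (invariants B ρ) where
  toFun := mapInvariants
  map_one' := rfl
  map_mul' _ _ := rfl
  map_zero' := rfl
  map_add' _ _ := rfl

theorem nonempty_invariants_linearEquiv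
    (e : TwistedTensor B ρ ≃ₗ[SkewMonoidAlgebra B G] TwistedTensor B ρ') :
    Nonempty (invariants B ρ ≃ₗ[FixedPoints.subalgebra k B G] invariants B ρ') :=
  ⟨.ofLinearMap (mapInvariants e.toLinearMap) (mapInvariants e.symm.toLinearMap)
    (LinearMap.ext fun x => Subtype.ext (e.apply_symm_apply x.1))
    (LinearMap.ext fun x => Subtype.ext (e.symm_apply_apply x.1))⟩

variable (ρ) in
theorem endInvariants_injective [Finite G] {s : B} (hs : s ∈ freenessIdeal G B)
    (hreg : IsSMulRegular (TwistedTensor B ρ) s) : Function.Injective (endInvariants (B := B) ρ) :=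
  fun ψ ψ' h => by
    have heq : toLinearMap ψ = toLinearMap ψ' := linearMap_eq_of_eqOn_fixedPoints hs hreg
      fun x hx => congrArg Subtype.val (LinearMap.congr_fun h ⟨x, hx⟩)
    exact LinearMap.ext fun x => LinearMap.congr_fun heq x

end MapInvariants

section Extension

variable [MulSemiringAction G C] [SMulCommClass G k C]
  [Module B (TwistedTensor C ρ)] [IsScalarTower B C (TwistedTensor C ρ)]
  [Module B (TwistedTensor C ρ')] [IsScalarTower B C (TwistedTensor C ρ')]

theorem skewLinear_ext_of_eqOn_invariants [Finite G] {s : B} (hs : s ∈ freenessIdeal G B)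
    (hreg : IsSMulRegular (TwistedTensor C ρ') s)
    {ψ ψ' : TwistedTensor C ρ →ₗ[SkewMonoidAlgebra C G] TwistedTensor C ρ'}
    (h : ∀ z ∈ invariants B ρ, ψ (extendScalars B C ρ z) = ψ' (extendScalars B C ρ z)) :
    ψ = ψ' := by
  have heq : (toLinearMap ψ).restrictScalars B ∘ₗ extendScalars B C ρ =
      (toLinearMap ψ').restrictScalars B ∘ₗ extendScalars B C ρ :=
    linearMap_eq_of_eqOn_fixedPoints hs hreg h
  refine skewLinear_ext fun v => ?_
  have hv := LinearMap.congr_fun heq (inclusion B ρ v)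
  simp only [LinearMap.comp_apply, extendScalars_inclusion] at hv
  exact hv

variable [SMulDistribClass G B C]

instance : SMulDistribClass G B (TwistedTensor C ρ) where
  smul_distrib_smul g b x := by
    rw [← smul_one_smul C b x, smul_distrib_smul g (b • (1 : C)) x, smul_distrib_smul g b (1 : C),
      smul_one, smul_one_smul]

theorem extendScalars_group_smul (g : G) (x : TwistedTensor B ρ) :
    extendScalars B C ρ (g • x) = g • extendScalars B C ρ x := by
  induction x using TwistedTensor.induction_on with
  | tmul b v => simp only [group_smul_tmul, extendScalars_tmul, algebraMap.smul']
  | add x y hx hy => rw [smul_add, map_add, hx, hy, map_add, smul_add]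

theorem exists_skewLinear_extension [Finite G] {s t : B} (hs : s ∈ freenessIdeal G B)
    (ht : t ∈ freenessIdeal G B) (hst : IsWeaklyRegular (TwistedTensor C ρ') [s, t])
    {φ : invariants B ρ →ₗ[FixedPoints.subalgebra k B G] TwistedTensor C ρ'}
    (hφ : ∀ z (g : G), g • φ z = φ z) :
    ∃ ψ : TwistedTensor C ρ →ₗ[SkewMonoidAlgebra C G] TwistedTensor C ρ',
      ∀ z : invariants B ρ, ψ (extendScalars B C ρ z) = φ z := by
  have hrange : Set.range (invariants B ρ).subtype = MulAction.fixedPoints G (TwistedTensor B ρ) :=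
    Subtype.range_coe
  obtain ⟨χ, hχφ, hχ⟩ := exists_equivariant_extension (invariants B ρ).injective_subtype hrange hφ
    hs ht hst
  have : IsScalarTower k B (TwistedTensor C ρ') := .to₁₂₄ k B C _
  let η : V →ₗ[k] TwistedTensor C ρ' := χ.restrictScalars k ∘ₗ inclusion B ρ
  have hη : ∀ (g : G) v, η (ρ g v) = g • η v := fun g v => by
    change χ (inclusion B ρ (ρ g v)) = g • χ (inclusion B ρ v)
    rw [inclusion_group_smul, hχ]
  have heq : (toLinearMap (lift η hη)).restrictScalars B ∘ₗ extendScalars B C ρ = χ := by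
    refine linearMap_ext fun v => ?_
    change lift η hη (extendScalars B C ρ (inclusion B ρ v)) = η v
    rw [extendScalars_inclusion, lift_inclusion]
  exact ⟨lift η hη, fun z => (LinearMap.congr_fun heq z).trans (hχφ z)⟩

end Extension

end TwistedTensor

section InvariantRing

section Noetherian

variable (k B G : Type*) [Field k] [CommRing B] [Algebra k B] [Algebra.FiniteType k B] [Group G]
  [Finite G] [MulSemiringAction G B] [SMulCommClass G k B]

theorem finite_over_fixedPoints : Module.Finite (FixedPoints.subalgebra k B G) B :=
  have : Algebra.IsIntegral (FixedPoints.subalgebra k B G) B := Algebra.IsInvariant.isIntegral _ _ G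
  have : Algebra.FiniteType (FixedPoints.subalgebra k B G) B := .of_restrictScalars_finiteType k _ _
  Algebra.IsIntegral.finite

theorem isNoetherianRing_fixedPoints : IsNoetherianRing (FixedPoints.subalgebra k B G) :=
  have := finite_over_fixedPoints k B G
  have : Algebra.FiniteType k (FixedPoints.subalgebra k B G) :=
    ⟨fg_of_fg_of_fg k _ B Algebra.FiniteType.out Module.Finite.fg_top Subtype.val_injective⟩
  Algebra.FiniteType.isNoetherianRing k _

end Noetherian

variable {A B G : Type*} [CommRing A] [CommRing B] [Algebra A B] [Group G] [MulSemiringAction G B]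
  {I : Ideal B} [IsStableIdeal G I]

theorem coeff_charpoly_mem_of_mem [Fintype G] {b : B} (hb : b ∈ I) {n : ℕ}
    (hn : n < (MulSemiringAction.charpoly G b).natDegree) :
    (MulSemiringAction.charpoly G b).coeff n ∈ I := by
  have hmap : (MulSemiringAction.charpoly G b).map (Ideal.Quotient.mk I) =
      Polynomial.X ^ Fintype.card G := by
    simp [MulSemiringAction.charpoly_eq, Polynomial.map_prod,
      Ideal.Quotient.eq_zero_iff_mem.mpr (IsStableIdeal.smul_mem _ b hb)]
  have hle : (MulSemiringAction.charpoly G b).natDegree ≤ Fintype.card G := by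
    refine (Polynomial.natDegree_prod_le Finset.univ _).trans ?_
    refine (Finset.sum_le_card_nsmul _ _ 1 fun g _ => Polynomial.natDegree_X_sub_C_le _).trans ?_
    rw [smul_eq_mul, mul_one, Finset.card_univ]
  rw [← Ideal.Quotient.eq_zero_iff_mem, ← Polynomial.coeff_map, hmap, Polynomial.coeff_X_pow,
    if_neg (hn.trans_le hle).ne]

theorem isWeaklyEisensteinAt_charpoly [Fintype G] [Algebra.IsInvariant A B G] {b : B} (hb : b ∈ I) :
    (MulSemiringAction.charpoly G b).IsWeaklyEisensteinAt
      ((I.comap (algebraMap A B)).map (algebraMap A B)) where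
  mem {n} hn := by
    obtain ⟨a, ha⟩ := Algebra.IsInvariant.isInvariant (A := A) _
      (MulSemiringAction.smul_coeff_charpoly (G := G) b n)
    rw [← ha]
    refine Ideal.mem_map_of_mem _ ?_
    rw [Ideal.mem_comap, ha]
    exact coeff_charpoly_mem_of_mem hb hn

variable (A G I) in
theorem exists_pow_le_map_comap_of_isInvariant [Finite G] [Algebra.IsInvariant A B G]
    [IsNoetherianRing B] : ∃ n : ℕ, I ^ n ≤ (I.comap (algebraMap A B)).map (algebraMap A B) := by
  have := Fintype.ofFinite G
  refine Ideal.exists_pow_le_of_le_radical_of_fg (fun b hb => ?_) (IsNoetherian.noetherian I)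
  exact ⟨_, (isWeaklyEisensteinAt_charpoly hb).pow_natDegree_le_of_root_of_monic_mem
    (MulSemiringAction.eval_charpoly G b) (MulSemiringAction.monic_charpoly G b) _ le_rfl⟩

end InvariantRing

section ArtinRees
universe u
variable {R : Type u} {M N : Type*} [CommRing R] [IsNoetherianRing R] [AddCommGroup M] [Module R M]
  [AddCommGroup N] [Module R N] [Module.Finite R N]

/-- `AdicCompletion.map_injective` requires the ring and the modules to be in one universe. -/
theorem adicCompletion_map_injective (J : Ideal R) {f : M →ₗ[R] N} (hf : Function.Injective f) :
    Function.Injective (AdicCompletion.map J f) := by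
  obtain ⟨n, K, ⟨e⟩⟩ := Module.Finite.exists_fin_quot_equiv R N
  let g : M →ₗ[R] (Fin n → R) ⧸ K := e.symm.toLinearMap ∘ₗ f
  have hg : Function.Injective g := e.symm.injective.comp hf
  have hcomp : g.range.subtype ∘ₗ (LinearEquiv.ofInjective g hg).toLinearMap = g := rfl
  have hinj : Function.Injective (AdicCompletion.map J g) := by
    rw [← hcomp, ← AdicCompletion.map_comp]
    exact (AdicCompletion.map_injective J g.range.injective_subtype).comp
      (AdicCompletion.congr J (LinearEquiv.ofInjective g hg)).injective
  rw [← AdicCompletion.map_comp, LinearMap.coe_comp] at hinj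
  exact hinj.of_comp

end ArtinRees

section Augmentation

variable {k B G : Type*} [Field k] [CommRing B] [Algebra k B] [Group G] [MulSemiringAction G B]
  [SMulCommClass G k B] {I : Ideal B} [IsStableIdeal G I]

instance : SMulDistribClass G B (AdicCompletion I B) where
  smul_distrib_smul g b x := by
    rw [Algebra.smul_def, Algebra.smul_def, smul_mul']
    exact congrArg (· * g • x) (completion_smul_of G I g b)

/-- The augmentation `B̂ → B ⧸ I = k` of the `I`-adic completion of `B`. -/
noncomputable def completionAugmentation (hI : Function.Bijective (algebraMap k (B ⧸ I))) :
    AdicCompletion I B →ₐ[k] k :=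
  ((AlgEquiv.ofBijective (Algebra.ofId k (B ⧸ I)) hI).symm : (B ⧸ I) →ₐ[k] k).comp
    ((AdicCompletion.evalOneₐ I).restrictScalars k)

variable (hI : Function.Bijective (algebraMap k (B ⧸ I)))

theorem algebraMap_completionAugmentation (x : AdicCompletion I B) :
    algebraMap k (B ⧸ I) (completionAugmentation hI x) = AdicCompletion.evalOneₐ I x :=
  (AlgEquiv.ofBijective (Algebra.ofId k (B ⧸ I)) hI).apply_symm_apply _

theorem completionAugmentation_smul (g : G) (x : AdicCompletion I B) :
    completionAugmentation hI (g • x) = completionAugmentation hI x := by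
  apply hI.injective
  set c := completionAugmentation hI x
  obtain ⟨b, hb⟩ := Ideal.Quotient.mk_surjective (AdicCompletion.evalₐ I 1 x)
  have hbc : b - algebraMap k B c ∈ I := by
    rw [← Ideal.Quotient.eq]
    refine Eq.trans ?_ (algebraMap_completionAugmentation hI x).symm
    rw [← AdicCompletion.factorₐ_evalₐ_one, ← hb]
    rfl
  have hgb : AdicCompletion.evalₐ I 1 (g • x) = Ideal.Quotient.mk (I ^ 1) (g • b) := by
    refine (evalₐ_completionSMul G I g 1 x).trans ?_
    rw [← hb]
    rfl
  have hgbc := IsStableIdeal.smul_mem g _ hbc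
  rw [smul_sub, smul_algebraMap, ← Ideal.Quotient.eq] at hgbc
  rw [algebraMap_completionAugmentation, ← AdicCompletion.factorₐ_evalₐ_one, hgb]
  exact hgbc

theorem isHausdorff_ker_completionAugmentation (hfg : I.FG) :
    IsHausdorff (RingHom.ker (completionAugmentation hI)) (AdicCompletion I B) := by
  have hker : RingHom.ker (completionAugmentation hI) =
      I.map (algebraMap B (AdicCompletion I B)) := by
    rw [← AdicCompletion.ker_evalOneₐ_eq_map I hfg]
    ext x
    rw [RingHom.mem_ker, ← map_eq_zero_iff _ hI.injective, algebraMap_completionAugmentation]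
    exact RingHom.mem_ker.symm
  rw [hker, IsHausdorff.map_algebraMap_iff]
  infer_instance

end Augmentation

namespace TwistedTensor

variable {k G V V' : Type*} [Field k] [Group G] [AddCommGroup V] [Module k V]
  [FiniteDimensional k V] [AddCommGroup V'] [Module k V'] [FiniteDimensional k V']

section Basis

variable (C : Type*) [CommRing C] [Algebra k C] (ρ : Representation k G V)

/-- The basis of `C ⊗ V` consisting of the vectors of a basis of `V`. -/
noncomputable def basis : Module.Basis (Fin (Module.finrank k V)) C (TwistedTensor C ρ) :=
  (Module.finBasis k V).baseChange C

theorem basis_repr_inclusion (v : V) (i) :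
    (basis C ρ).repr (inclusion C ρ v) i = algebraMap k C ((Module.finBasis k V).repr v i) := by
  refine (Module.Basis.baseChange_repr_tmul C _ (1 : C) v i).trans ?_
  rw [Algebra.smul_def, mul_one]

end Basis

variable {B : Type*} [CommRing B] [Algebra k B]

section CompletionEquiv

variable {ρ : Representation k G V} (I : Ideal B)

noncomputable instance : Module B (TwistedTensor (AdicCompletion I B) ρ) :=
  inferInstanceAs (Module B (AdicCompletion I B ⊗[k] V))

instance : IsScalarTower B (AdicCompletion I B) (TwistedTensor (AdicCompletion I B) ρ) :=
  inferInstanceAs (IsScalarTower B (AdicCompletion I B) (AdicCompletion I B ⊗[k] V))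

variable (ρ) in
/-- The isomorphism of the `I`-adic completion of `B ⊗ V` with `B̂ ⊗ V`. -/
noncomputable def completionEquiv :
    AdicCompletion I (TwistedTensor B ρ) ≃ₗ[AdicCompletion I B]
      TwistedTensor (AdicCompletion I B) ρ :=
  ((AdicCompletion.congr I (basis B ρ).equivFun).trans
    (AdicCompletion.piEquivOfFintype I fun _ => B)).trans
    (basis (AdicCompletion I B) ρ).equivFun.symm

theorem repr_completionEquiv (x : AdicCompletion I (TwistedTensor B ρ)) (i) :
    (basis (AdicCompletion I B) ρ).repr (completionEquiv ρ I x) i =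
      AdicCompletion.map I ((basis B ρ).coord i) x := by
  refine (congrFun ((basis _ ρ).equivFun.apply_symm_apply _) i).trans ?_
  refine (congrFun (AdicCompletion.piEquivOfFintype_apply I (fun _ => B) _) i).trans ?_
  exact AdicCompletion.map_comp_apply I _ _ x

theorem completionEquiv_of (x : TwistedTensor B ρ) :
    completionEquiv ρ I (AdicCompletion.of I _ x) = extendScalars B (AdicCompletion I B) ρ x := by
  have h : (completionEquiv ρ I).toLinearMap.restrictScalars B ∘ₗ AdicCompletion.of I _ =
      extendScalars B (AdicCompletion I B) ρ := by
    refine linearMap_ext fun v => (basis _ ρ).ext_elem fun i => ?_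
    rw [extendScalars_inclusion, basis_repr_inclusion]
    refine (repr_completionEquiv I _ i).trans ?_
    rw [AdicCompletion.map_of, Module.Basis.coord_apply, basis_repr_inclusion]
    rfl
  exact LinearMap.congr_fun h x

end CompletionEquiv

section Comparison

open RingTheory.Sequence

variable [MulSemiringAction G B] [SMulCommClass G k B] (ρ : Representation k G V)
  (ρ' : Representation k G V') (I : Ideal B)

/-- The comparison map from the completion of the module of invariants of `B ⊗ V` to `B̂ ⊗ V`. -/
noncomputable def comparison :
    AdicCompletion (I.comap (algebraMap (FixedPoints.subalgebra k B G) B)) (invariants B ρ)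
      →ₗ[FixedPoints.subalgebra k B G] TwistedTensor (AdicCompletion I B) ρ :=
  ((completionEquiv ρ I).toLinearMap.restrictScalars B).restrictScalars _ ∘ₗ
    adicCompletionMapOfLE _ Ideal.map_comap_le ∘ₗ
    (AdicCompletion.map _ (invariants B ρ).subtype).restrictScalars _

theorem comparison_of (z : invariants B ρ) :
    comparison ρ I (AdicCompletion.of _ _ z) = extendScalars B (AdicCompletion I B) ρ z := by
  refine Eq.trans ?_ (completionEquiv_of I z.1)
  change completionEquiv ρ I (adicCompletionMapOfLE _ Ideal.map_comap_le
    (AdicCompletion.map _ (invariants B ρ).subtype _)) = _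
  rw [AdicCompletion.map_of, adicCompletionMapOfLE_of]
  rfl

theorem comparison_injective [Finite G] [Algebra.FiniteType k B] [IsStableIdeal G I] :
    Function.Injective (comparison ρ I) := by
  have := finite_over_fixedPoints k B G
  have := isNoetherianRing_fixedPoints k B G
  have := Algebra.FiniteType.isNoetherianRing k B
  have : Module.Finite (FixedPoints.subalgebra k B G) (TwistedTensor B ρ) := .trans B _
  obtain ⟨n, hn⟩ := exists_pow_le_map_comap_of_isInvariant (FixedPoints.subalgebra k B G) G I
  exact (completionEquiv ρ I).injective.comp <|
    (adicCompletionMapOfLE_injective Ideal.map_comap_le hn).comp <|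
      adicCompletion_map_injective _ (invariants B ρ).injective_subtype

theorem isHausdorff_comap_fixedPoints {C : Type*} [CommRing C] [Algebra k C] [Algebra B C]
    [Module B (TwistedTensor C ρ)] [IsScalarTower B C (TwistedTensor C ρ)] [IsHausdorff I C] :
    IsHausdorff (I.comap (algebraMap (FixedPoints.subalgebra k B G) B)) (TwistedTensor C ρ) :=
  have : IsHausdorff (I.map (algebraMap B C)) C := IsHausdorff.map_algebraMap_iff.mpr ‹_›
  have : IsHausdorff (I.map (algebraMap B C)) (TwistedTensor C ρ) := isHausdorff_of_free
  have : IsHausdorff I (TwistedTensor C ρ) := IsHausdorff.map_algebraMap_iff.mp this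
  .of_map (J := I) Ideal.map_comap_le

theorem adicCompletion_of_invariants_injective [IsHausdorff I B] :
    Function.Injective (AdicCompletion.of
      (I.comap (algebraMap (FixedPoints.subalgebra k B G) B)) (invariants B ρ)) := by
  have := isHausdorff_comap_fixedPoints (C := B) ρ I
  have := isHausdorff_of_injective (J := I.comap (algebraMap (FixedPoints.subalgebra k B G) B))
    (invariants B ρ).injective_subtype
  exact AdicCompletion.of_injective _ _

variable [Finite G] [Algebra.FiniteType k B] [IsStableIdeal G I]

theorem group_smul_comparison (g : G) (x) : g • comparison ρ I x = comparison ρ I x := by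
  have := isNoetherianRing_fixedPoints k B G
  let τ : TwistedTensor (AdicCompletion I B) ρ →ₗ[FixedPoints.subalgebra k B G]
      TwistedTensor (AdicCompletion I B) ρ :=
    { DistribSMul.toAddMonoidHom _ g with
      map_smul' := fun a x => by
        change g • (a : B) • x = (a : B) • g • x
        rw [smul_distrib_smul, a.2 g] }
  have := isHausdorff_comap_fixedPoints (C := AdicCompletion I B) ρ I
  have h : τ ∘ₗ comparison ρ I = comparison ρ I :=
    adicCompletion_hom_ext (IsNoetherian.noetherian _) fun z => by
      change g • comparison ρ I _ = comparison ρ I _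
      rw [comparison_of, ← extendScalars_group_smul, mem_invariants.mp z.2 g]
  exact LinearMap.congr_fun h x

theorem hasUniqueExtensions_comparison {s t : B} (hs : s ∈ freenessIdeal G B)
    (ht : t ∈ freenessIdeal G B) (hst : IsWeaklyRegular B [s, t]) :
    HasUniqueExtensions
      (AdicCompletion (I.comap (algebraMap (FixedPoints.subalgebra k B G) B))
        (FixedPoints.subalgebra k B G))
      (SkewMonoidAlgebra (AdicCompletion I B) G)
      (comparison ρ I).toAddMonoidHom (comparison ρ' I).toAddMonoidHom := fun f => by
  have := isNoetherianRing_fixedPoints k B G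
  have := Algebra.FiniteType.isNoetherianRing k B
  have : Module.Flat B (TwistedTensor (AdicCompletion I B) ρ') := .trans B (AdicCompletion I B) _
  have hst' := isWeaklyRegular_module_of_flat (TwistedTensor (AdicCompletion I B) ρ') hst
  have := isHausdorff_comap_fixedPoints (C := AdicCompletion I B) ρ' I
  let f' := f.restrictScalars (FixedPoints.subalgebra k B G)
  obtain ⟨ψ, hψ⟩ := exists_skewLinear_extension (ρ := ρ)
    (φ := comparison ρ' I ∘ₗ f' ∘ₗ AdicCompletion.of _ _) hs ht hst'
    fun z g => group_smul_comparison ρ' I g _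
  have hext : (toLinearMap ψ).restrictScalars (FixedPoints.subalgebra k B G) ∘ₗ comparison ρ I =
      comparison ρ' I ∘ₗ f' :=
    adicCompletion_hom_ext (IsNoetherian.noetherian _) fun z => by
      change ψ (comparison ρ I _) = _
      rw [comparison_of, hψ]
      rfl
  refine ⟨ψ, LinearMap.congr_fun hext, fun ψ' hψ' => ?_⟩
  have hsreg := ((isWeaklyRegular_cons_iff _ _ _).mp hst').1
  refine skewLinear_ext_of_eqOn_invariants hs hsreg fun z hz => ?_
  rw [← comparison_of ρ I ⟨z, hz⟩]
  exact (hψ' _).trans (LinearMap.congr_fun hext _).symm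

variable {ρ ρ' I} in
theorem nonempty_linearEquiv_of_adicCompletion_invariants {s t : B} (hs : s ∈ freenessIdeal G B)
    (ht : t ∈ freenessIdeal G B) (hst : IsWeaklyRegular B [s, t])
    (e : AdicCompletion (I.comap (algebraMap (FixedPoints.subalgebra k B G) B)) (invariants B ρ)
      ≃ₗ[AdicCompletion (I.comap (algebraMap (FixedPoints.subalgebra k B G) B))
          (FixedPoints.subalgebra k B G)]
        AdicCompletion (I.comap (algebraMap (FixedPoints.subalgebra k B G) B))
          (invariants B ρ')) :
    Nonempty (TwistedTensor (AdicCompletion I B) ρ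
      ≃ₗ[SkewMonoidAlgebra (AdicCompletion I B) G] TwistedTensor (AdicCompletion I B) ρ') :=
  (hasUniqueExtensions_comparison ρ ρ' I hs ht hst).nonempty_linearEquiv
    (hasUniqueExtensions_comparison ρ' ρ I hs ht hst)
    (hasUniqueExtensions_comparison ρ ρ I hs ht hst)
    (hasUniqueExtensions_comparison ρ' ρ' I hs ht hst) e

end Comparison

end TwistedTensor

open TwistedTensor in
theorem mainTheorem9_general {k B G : Type*} [Field k] [CommRing B] [IsDomain B]
    [UniqueFactorizationMonoid B] [Algebra k B] [Algebra.FiniteType k B] [Group G] [Finite G]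
    [MulSemiringAction G B] [SMulCommClass G k B] (hsmall : IsSmallAction G B)
    (I : Ideal B) [IsStableIdeal G I] (hI : Function.Bijective (algebraMap k (B ⧸ I))) :
    (∀ {V : Type*} [AddCommGroup V] [Module k V] [FiniteDimensional k V]
      (ρ : Representation k G V),
      List.TFAE [
        IsIndecomposableModule (MonoidAlgebra k G) ρ.asModule,
        IsIndecomposableModule (SkewMonoidAlgebra B G) (TwistedTensor B ρ),
        IsIndecomposableModule (SkewMonoidAlgebra (AdicCompletion I B) G)
          (TwistedTensor (AdicCompletion I B) ρ),
        IsIndecomposableModule (FixedPoints.subalgebra k B G) (invariants B ρ),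
        IsIndecomposableModule
          (AdicCompletion (I.comap (algebraMap (FixedPoints.subalgebra k B G) B))
            (FixedPoints.subalgebra k B G))
          (AdicCompletion (I.comap (algebraMap (FixedPoints.subalgebra k B G) B))
            (invariants B ρ))]) ∧
    (∀ {V V' : Type*} [AddCommGroup V] [Module k V] [FiniteDimensional k V]
      [AddCommGroup V'] [Module k V'] [FiniteDimensional k V']
      (ρ : Representation k G V) (ρ' : Representation k G V'),
      List.TFAE [
        Nonempty (ρ.asModule ≃ₗ[MonoidAlgebra k G] ρ'.asModule),
        Nonempty (TwistedTensor B ρ ≃ₗ[SkewMonoidAlgebra B G] TwistedTensor B ρ'),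
        Nonempty (TwistedTensor (AdicCompletion I B) ρ
          ≃ₗ[SkewMonoidAlgebra (AdicCompletion I B) G] TwistedTensor (AdicCompletion I B) ρ'),
        Nonempty (invariants B ρ ≃ₗ[FixedPoints.subalgebra k B G] invariants B ρ'),
        Nonempty
          (AdicCompletion (I.comap (algebraMap (FixedPoints.subalgebra k B G) B)) (invariants B ρ)
            ≃ₗ[AdicCompletion (I.comap (algebraMap (FixedPoints.subalgebra k B G) B))
                (FixedPoints.subalgebra k B G)]
              AdicCompletion (I.comap (algebraMap (FixedPoints.subalgebra k B G) B))
                (invariants B ρ'))]) := by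
  have := isNoetherianRing_fixedPoints k B G
  have := Algebra.FiniteType.isNoetherianRing k B
  obtain ⟨s, hs, t, ht, hst⟩ :=
    exists_isWeaklyRegular_pair_of_two_le_height hsmall.two_le_height_freenessIdeal
  have hε := completionAugmentation_smul (G := G) hI
  refine ⟨fun ρ => ?_, fun ρ ρ' => ?_⟩
  · have hreg := isWeaklyRegular_module_of_flat (TwistedTensor B ρ) hst
    have hsreg := ((RingTheory.Sequence.isWeaklyRegular_cons_iff _ _ _).mp hreg).1
    have : IsHausdorff I B := .of_isDomain _ (Ideal.Quotient.nontrivial_iff.mp hI.1.nontrivial)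
    have := isHausdorff_ker_completionAugmentation hI (IsNoetherian.noetherian I)
    tfae_have 1 → 3 := isIndecomposableModule_of_asModule _ hε
    tfae_have 3 → 5 := (hasUniqueExtensions_comparison ρ ρ I hs ht hst).isIndecomposableModule
      (comparison_injective ρ I)
    tfae_have 5 → 4 := (hasUniqueExtensions_adicCompletion (IsNoetherian.noetherian _)
      ).isIndecomposableModule (adicCompletion_of_invariants_injective ρ I)
    tfae_have 4 → 2 := .of_injective_ringHom (endInvariants ρ) (endInvariants_injective ρ hs hsreg)
    tfae_have 2 → 1 := (hasUniqueExtensions_asModuleInclusion B ρ ρ).isIndecomposableModule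
      (asModuleInclusion_injective B ρ)
    tfae_finish
  · tfae_have 1 → 2 := fun ⟨e⟩ => nonempty_linearEquiv_of_asModule B e
    tfae_have 2 → 4 := fun ⟨e⟩ => nonempty_invariants_linearEquiv e
    tfae_have 4 → 5 := fun ⟨e⟩ => ⟨AdicCompletion.congr _ e⟩
    tfae_have 5 → 3 := fun ⟨e⟩ => nonempty_linearEquiv_of_adicCompletion_invariants hs ht hst e
    tfae_have 3 → 1 := fun ⟨e⟩ => nonempty_asModule_linearEquiv _ hε e
    tfae_finish

section Grading

variable {k B : Type*} [Field k] [CommRing B] [Algebra k B] {𝒜 : ℕ → Submodule k B}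

theorem IsGradedPolynomialRing.exists_mvPolynomial_algEquiv (h : IsGradedPolynomialRing 𝒜) :
    ∃ r : ℕ, Nonempty (MvPolynomial (Fin r) k ≃ₐ[k] B) := by
  obtain ⟨r, _, x, -, hx, htop⟩ := h
  exact ⟨r, ⟨hx.aevalEquiv.trans ((Subalgebra.equivOfEq _ _ htop).trans Subalgebra.topEquiv)⟩⟩

variable [GradedAlgebra 𝒜]

variable (𝒜) in
theorem irrelevantIdeal_ne_top [Nontrivial B] : irrelevantIdeal 𝒜 ≠ ⊤ := by
  rw [Ideal.ne_top_iff_one]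
  intro h
  have h0 : GradedRing.proj 𝒜 0 1 = 0 := h
  rw [GradedRing.proj_apply, DirectSum.decompose_of_mem_same 𝒜 SetLike.GradedOne.one_mem] at h0
  exact one_ne_zero h0

theorem IsGradedPolynomialRing.bijective_algebraMap_quotient [Nontrivial B]
    (h : IsGradedPolynomialRing 𝒜) :
    Function.Bijective (algebraMap k (B ⧸ irrelevantIdeal 𝒜)) := by
  have := Ideal.Quotient.nontrivial_iff.mpr (irrelevantIdeal_ne_top 𝒜)
  refine ⟨(algebraMap k _).injective, ?_⟩
  obtain ⟨r, d, x, hd, -, htop⟩ := h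
  have hx : ∀ i, Ideal.Quotient.mkₐ k (irrelevantIdeal 𝒜) (x i) = 0 := fun i =>
    Ideal.Quotient.eq_zero_iff_mem.mpr
      (HomogeneousIdeal.mem_irrelevant_of_mem 𝒜 (hd i).1 (hd i).2)
  have hrange : (Ideal.Quotient.mkₐ k (irrelevantIdeal 𝒜)).range = ⊥ := by
    rw [← Algebra.map_top, ← htop, AlgHom.map_adjoin, eq_bot_iff, Algebra.adjoin_le_iff]
    rintro _ ⟨_, ⟨i, rfl⟩, rfl⟩
    rw [hx]
    exact zero_mem _
  rw [(AlgHom.range_eq_top _).mpr (Ideal.Quotient.mkₐ_surjective k _)] at hrange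
  exact Algebra.surjective_algebraMap_iff.mpr hrange

end Grading

theorem mainTheorem9 {k : Type*} [Field k] {B : Type*} [CommRing B] [Algebra k B]
    (𝒜 : ℕ → Submodule k B) [GradedAlgebra 𝒜] (hB : IsGradedPolynomialRing 𝒜)
    {G : Type*} [Group G] [Finite G] [MulSemiringAction G B] [SMulCommClass G k B]
    [FaithfulSMul G B] [IsGradedAction 𝒜 G] (hsmall : IsSmallAction G B) :
    (∀ {V : Type*} [AddCommGroup V] [Module k V] [FiniteDimensional k V]
      (ρ : Representation k G V),
      List.TFAE [
        IsIndecomposableModule (MonoidAlgebra k G) ρ.asModule,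
        IsIndecomposableModule (SkewMonoidAlgebra B G) (TwistedTensor B ρ),
        IsIndecomposableModule
          (SkewMonoidAlgebra (AdicCompletion (irrelevantIdeal 𝒜) B) G)
          (TwistedTensor (AdicCompletion (irrelevantIdeal 𝒜) B) ρ),
        IsIndecomposableModule (FixedPoints.subalgebra k B G) (TwistedTensor.invariants B ρ),
        IsIndecomposableModule
          (AdicCompletion (invariantIrrelevantIdeal 𝒜 G) (FixedPoints.subalgebra k B G))
          (AdicCompletion (invariantIrrelevantIdeal 𝒜 G) (TwistedTensor.invariants B ρ))]) ∧
    (∀ {V V' : Type*} [AddCommGroup V] [Module k V] [FiniteDimensional k V]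
      [AddCommGroup V'] [Module k V'] [FiniteDimensional k V']
      (ρ : Representation k G V) (ρ' : Representation k G V'),
      List.TFAE [
        Nonempty (ρ.asModule ≃ₗ[MonoidAlgebra k G] ρ'.asModule),
        Nonempty (TwistedTensor B ρ ≃ₗ[SkewMonoidAlgebra B G] TwistedTensor B ρ'),
        Nonempty
          (TwistedTensor (AdicCompletion (irrelevantIdeal 𝒜) B) ρ
            ≃ₗ[SkewMonoidAlgebra (AdicCompletion (irrelevantIdeal 𝒜) B) G]
              TwistedTensor (AdicCompletion (irrelevantIdeal 𝒜) B) ρ'),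
        Nonempty (TwistedTensor.invariants B ρ
          ≃ₗ[FixedPoints.subalgebra k B G] TwistedTensor.invariants B ρ'),
        Nonempty
          (AdicCompletion (invariantIrrelevantIdeal 𝒜 G) (TwistedTensor.invariants B ρ)
            ≃ₗ[AdicCompletion (invariantIrrelevantIdeal 𝒜 G) (FixedPoints.subalgebra k B G)]
              AdicCompletion (invariantIrrelevantIdeal 𝒜 G)
                (TwistedTensor.invariants B ρ'))]) := by
  obtain ⟨_, ⟨e⟩⟩ := hB.exists_mvPolynomial_algEquiv
  have := e.symm.toMulEquiv.isDomain
  have := e.toMulEquiv.uniqueFactorizationMonoid inferInstance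
  have : Algebra.FiniteType k B := .equiv inferInstance e
  exact mainTheorem9_general hsmall (irrelevantIdeal 𝒜) hB.bijective_algebraMap_quotient
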